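/- Let $d\ge 0$, $\ell,k,m\ge 1$ be integers with $k\mid \ell$ and $m>d$. **Groupoids and algebras.** Let $\mathcal G_{(\ell,d)}$ be the groupoid whose objects are the maps $f:\{1,\dots,d\}\to\{1,\dots,\ell\}$ and whose morphisms $f\to g$ are the permutations $\sigma\in S_d$ with $g\circ\sigma=f$, composed as maps. Let $\theta$ be the cycle $i\mapsto i+1$ (with $\ell\mapsto 1$) on $\{1,\dots,\ell\}$ and let $H_k=\langle\theta^{\ell/k}\rangle$ act on $\mathcal G_{(\ell,d)}$ by $f\mapsto h\circ f$ on objects and by leaving the underlying permutation of a morphism unchanged. Let $\mathcal G^k_{(\ell,d)}=\mathcal G_{(\ell,d)}/H_k$ be the quotient groupoid: its objects and morphisms are the $H_k$-orbits of objects and morphisms, with the induced composition. Let $A_{(\ell,d)}$ and $A_{(\ell,k,d)}$ be the complex algebras of these two groupoids: the basis is the set of all morphisms, the product is composition, and products of non-composable morphisms are $0$. Let $\Psi:A_{(\ell,k,d)}\to A_{(\ell,d)}$ be the algebra homomorphism sending an orbit of morphisms to the sum of the morphisms in it. **Actions.** Let $V=\mathbb C^{\ell m}$ with standard basis $v_1,\dots,v_{\ell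 m}$, and let $V=V_1\oplus\dots\oplus V_\ell$ where $V_c$ is spanned by $v_{(c-1)m+1},\dots,v_{cm}$. The algebra $A_{(\ell,d)}$ acts on $V^{\otimes d}$ as follows: a morphism $\sigma:f\to g$ acts on $V_{f(1)}\otimes\dots\otimes V_{f(d)}$ by $w_1\otimes\dots\otimes w_d\mapsto w_{\sigma^{-1}(1)}\otimes\dots\otimes w_{\sigma^{-1}(d)}$, and by $0$ on $V_{f'(1)}\otimes\dots\otimes V_{f'(d)}$ for $f'\ne f$. The algebra $A_{(\ell,k,d)}$ acts on $V^{\otimes d}$ through $\Psi$. The group $\mathrm{GL}_{(m,\dots,m)}=\mathrm{GL}_m(\mathbb C)^{\ell}$ acts on $V$ by block-diagonal matrices, the generator of $\mathbb Z$ acts on $V$ by $v_i\mapsto v_{i+\frac{\ell}{k}m}$ (indices modulo $\ell m$), and the free product $\mathrm{GL}_{(m,\dots,m)}*\mathbb Z$ acts diagonally on $V^{\otimes d}$. **Theorem (Schur–Weyl duality for $G(\ell,k,d)$).** The actions of $\mathrm{GL}_{(m,\dots,m)}*\mathbb Z$ and of $A_{(\ell,k,d)}$ on $V^{\otimes d}$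 generate each other's centralizers: the algebra of linear operators on $V^{\otimes d}$ commuting with the action of $\mathrm{GL}_{(m,\dots,m)}*\mathbb Z$ is the image of $A_{(\ell,k,d)}$, and the algebra of linear operators commuting with the action of $A_{(\ell,k,d)}$ is the image of the group algebra $\mathbb C[\mathrm{GL}_{(m,\dots,m)}*\mathbb Z]$. Moreover, let $G(\ell,k,d)$ be the group of complex $d\times d$ matrices with exactly one nonzero entry in each row and column, such that the nonzero entries are $\ell$-th roots of unity whose product is an $(\ell/k)$-th root of unity. Then there is an algebra isomorphism $e:\mathbb C[G(\ell,k,d)]\to A_{(\ell,k,d)}$ such that, for every $X\in G(\ell,k,d)$ with nonzero entries $z_j$ at the positions $(\sigma(j),j)$, $\sigma\in S_d$, $$\Psi(e(X))=\sum_{f}\Big(\prod_{j=1}^d z_j^{f(j)}\Big)\,\sigma_{(f,\,f\circ\sigma^{-1})},$$ where the sum is over all maps $f:\{1,\dots,d\}\to\{1,\dots,\ell\}$ and $\sigma_{(f,g)}$ denotes $\sigma$ viewed as a morphism $f\to g$. -/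

import Mathlib

open CategoryTheory
open scoped TensorProduct

noncomputable section

set_option linter.unusedSectionVars false
set_option linter.unusedSimpArgs false

namespace ColorGroupoid

/-! ### The algebra of a finite groupoid -/

section GroupoidAlgebra

variable (C : Type) [Groupoid.{0} C]

/-- The type of all arrows of a groupoid. -/
abbrev Arrows : Type := Σ f g : C, (f ⟶ g)

/-- The algebra of a finite groupoid `C`: the complex vector space whose basis is the set of
all arrows of `C`, that is `⨁ f g, ℂ[C(f, g)]`. An element is given by its coefficients. -/
def GroupoidAlgebra : Type := Arrows C → ℂ

variable {C}

namespace GroupoidAlgebra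

instance : AddCommGroup (GroupoidAlgebra C) := inferInstanceAs (AddCommGroup (Arrows C → ℂ))
instance : Module ℂ (GroupoidAlgebra C) := inferInstanceAs (Module ℂ (Arrows C → ℂ))

@[ext] theorem ext {a b : GroupoidAlgebra C} (h : ∀ x : Arrows C, a x = b x) : a = b := funext h

theorem add_apply (a b : GroupoidAlgebra C) (x : Arrows C) : (a + b) x = a x + b x := rfl
theorem zero_apply (x : Arrows C) : (0 : GroupoidAlgebra C) x = 0 := rfl
theorem smul_apply (c : ℂ) (a : GroupoidAlgebra C) (x : Arrows C) : (c • a) x = c * a x := rfl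

open Classical in
/-- The basis element given by an arrow. -/
def single {f g : C} (σ : f ⟶ g) : GroupoidAlgebra C := fun x => if x = ⟨f, g, σ⟩ then 1 else 0

variable [Fintype C] [∀ f g : C, Fintype (f ⟶ g)]

/-- The product is the bilinear extension of composition of arrows (arrows being composed like
maps, so `τ * σ` is `τ` after `σ`, see `single_mul_single`), the product of non-composable
arrows being zero: the coefficient of `ρ : f ⟶ h` in `a * b` is the sum over all
factorisations of `ρ` as `τ` after `σ`, where `σ : f ⟶ g` and `τ = σ⁻¹ ≫ ρ : g ⟶ h`. -/
instance : Mul (GroupoidAlgebra C) where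
  mul a b := fun x => ∑ g : C, ∑ σ : (x.1 ⟶ g),
    a ⟨g, x.2.1, Groupoid.inv σ ≫ x.2.2⟩ * b ⟨x.1, g, σ⟩

open Classical in
/-- The unit is the sum of all identity arrows. -/
instance : One (GroupoidAlgebra C) where
  one := fun x => if x = ⟨x.1, x.1, 𝟙 x.1⟩ then 1 else 0

theorem mul_apply (a b : GroupoidAlgebra C) {f h : C} (ρ : f ⟶ h) :
    (a * b) ⟨f, h, ρ⟩ = ∑ g : C, ∑ σ : (f ⟶ g),
      a ⟨g, h, Groupoid.inv σ ≫ ρ⟩ * b ⟨f, g, σ⟩ := rfl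

open Classical in
theorem one_apply {f h : C} (ρ : f ⟶ h) :
    (1 : GroupoidAlgebra C) ⟨f, h, ρ⟩ =
      if (⟨f, h, ρ⟩ : Arrows C) = ⟨f, f, 𝟙 f⟩ then 1 else 0 := rfl

theorem mul_assoc' (a b c : GroupoidAlgebra C) : a * b * c = a * (b * c) := by
  ext ⟨f, h, ρ⟩
  simp only [mul_apply, Finset.sum_mul, Finset.mul_sum]
  have key : ∀ g : C, (∑ σ : (f ⟶ g), ∑ g' : C, ∑ τ : (g ⟶ g'),
      a ⟨g', h, Groupoid.inv τ ≫ Groupoid.inv σ ≫ ρ⟩ * b ⟨g, g', τ⟩ * c ⟨f, g, σ⟩) =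
      ∑ σ : (f ⟶ g), ∑ g' : C, ∑ υ : (f ⟶ g'),
      a ⟨g', h, Groupoid.inv υ ≫ ρ⟩ * (b ⟨g, g', Groupoid.inv σ ≫ υ⟩ * c ⟨f, g, σ⟩) := by
    intro g
    refine Finset.sum_congr rfl fun σ _ => Finset.sum_congr rfl fun g' _ => ?_
    refine Fintype.sum_equiv
      ⟨fun τ => σ ≫ τ, fun υ => Groupoid.inv σ ≫ υ, fun τ => by simp, fun υ => by simp⟩ _ _ ?_
    intro τ
    simp [mul_assoc, Groupoid.inv_eq_inv]
  rw [Finset.sum_congr rfl fun g _ => key g]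
  rw [Finset.sum_congr rfl fun g _ => Finset.sum_comm]
  rw [Finset.sum_comm]
  refine Finset.sum_congr rfl fun g' _ => ?_
  rw [Finset.sum_congr rfl fun g _ => Finset.sum_comm]
  rw [Finset.sum_comm]

theorem one_mul' (a : GroupoidAlgebra C) : 1 * a = a := by
  classical
  ext ⟨f, h, ρ⟩
  rw [mul_apply, Finset.sum_eq_single h, Finset.sum_eq_single ρ]
  · simp [one_apply]
  · intro σ _ hσ
    rw [one_apply, if_neg, zero_mul]
    intro h'
    apply hσ
    have h2 : Groupoid.inv σ ≫ ρ = 𝟙 h := by simpa using h'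
    have h3 := congrArg (fun t => σ ≫ t) h2
    simpa using h3.symm
  · simp
  · intro g _ hg
    refine Finset.sum_eq_zero fun σ _ => ?_
    rw [one_apply, if_neg, zero_mul]
    intro h'
    have := congrArg (fun x : Arrows C => x.2.1) h'
    exact hg this.symm
  · simp

theorem mul_one' (a : GroupoidAlgebra C) : a * 1 = a := by
  classical
  ext ⟨f, h, ρ⟩
  rw [mul_apply, Finset.sum_eq_single f, Finset.sum_eq_single (𝟙 f)]
  · simp [one_apply, Groupoid.inv_eq_inv]
  · intro σ _ hσ
    rw [one_apply, if_neg, mul_zero]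
    intro h'
    exact hσ (by simpa using h')
  · simp
  · intro g _ hg
    refine Finset.sum_eq_zero fun σ _ => ?_
    rw [one_apply, if_neg, mul_zero]
    intro h'
    exact hg (congrArg (fun x : Arrows C => x.2.1) h')
  · simp

instance : Ring (GroupoidAlgebra C) :=
  { (inferInstance : AddCommGroup (GroupoidAlgebra C)),
    (inferInstance : Mul (GroupoidAlgebra C)),
    (inferInstance : One (GroupoidAlgebra C)) with
    mul_assoc := mul_assoc'
    one_mul := one_mul'
    mul_one := mul_one'
    left_distrib := fun a b c => by
      ext ⟨f, h, ρ⟩; simp only [mul_apply, add_apply, mul_add, Finset.sum_add_distrib]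
    right_distrib := fun a b c => by
      ext ⟨f, h, ρ⟩; simp only [mul_apply, add_apply, add_mul, Finset.sum_add_distrib]
    zero_mul := fun a => by
      ext ⟨f, h, ρ⟩; simp only [mul_apply, zero_apply, zero_mul, Finset.sum_const_zero]
    mul_zero := fun a => by
      ext ⟨f, h, ρ⟩; simp only [mul_apply, zero_apply, mul_zero, Finset.sum_const_zero] }

instance : Algebra ℂ (GroupoidAlgebra C) :=
  Algebra.ofModule
    (fun r a b => by
      ext ⟨f, h, ρ⟩; simp only [mul_apply, smul_apply, mul_assoc, Finset.mul_sum])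
    (fun r a b => by
      ext ⟨f, h, ρ⟩; simp only [mul_apply, smul_apply, mul_left_comm, Finset.mul_sum])

theorem single_mul_single {f g h : C} (σ : f ⟶ g) (τ : g ⟶ h) :
    single τ * single σ = single (σ ≫ τ) := by
  classical
  ext ⟨f', h', ρ⟩
  rw [mul_apply]
  by_cases hf : f' = f
  · subst hf
    rw [Finset.sum_eq_single g, Finset.sum_eq_single σ]
    · by_cases hh : h' = h
      · subst hh
        have : Groupoid.inv σ ≫ ρ = τ ↔ ρ = σ ≫ τ := by
          constructor
          · rintro rfl; simp
          · rintro rfl; simp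
        simp [single, this]
      · have h1 : (⟨g, h', Groupoid.inv σ ≫ ρ⟩ : Arrows C) ≠ ⟨g, h, τ⟩ := fun e =>
          hh (congrArg (fun x : Arrows C => x.2.1) e)
        have h2 : (⟨f', h', ρ⟩ : Arrows C) ≠ ⟨f', h, σ ≫ τ⟩ := fun e =>
          hh (congrArg (fun x : Arrows C => x.2.1) e)
        simp only [single, if_neg h1, if_neg h2, zero_mul]
    · intro σ' _ hσ'
      have h1 : (⟨f', g, σ'⟩ : Arrows C) ≠ ⟨f', g, σ⟩ := fun e => hσ' (by simpa using e)
      simp only [single, if_neg h1, mul_zero]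
    · simp
    · intro g' _ hg'
      refine Finset.sum_eq_zero fun σ' _ => ?_
      have h1 : (⟨f', g', σ'⟩ : Arrows C) ≠ ⟨f', g, σ⟩ := fun e =>
        hg' (congrArg (fun x : Arrows C => x.2.1) e)
      simp only [single, if_neg h1, mul_zero]
    · simp
  · have h2 : (⟨f', h', ρ⟩ : Arrows C) ≠ ⟨f, h, σ ≫ τ⟩ := fun e =>
      hf (congrArg (fun x : Arrows C => x.1) e)
    rw [single, if_neg h2]
    refine Finset.sum_eq_zero fun g' _ => Finset.sum_eq_zero fun σ' _ => ?_
    have h1 : (⟨f', g', σ'⟩ : Arrows C) ≠ ⟨f, g, σ⟩ := fun e =>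
      hf (congrArg (fun x : Arrows C => x.1) e)
    simp only [single, if_neg h1, mul_zero]

end GroupoidAlgebra

end GroupoidAlgebra

/-! ### The groupoid of colourings -/

/-- Colourings of `d` points by `ℓ` colours. -/
@[ext] structure Coloring (ℓ d : ℕ) : Type where
  color : Fin d → Fin ℓ

variable {ℓ k d : ℕ}

instance : Finite (Coloring ℓ d) :=
  Finite.of_injective Coloring.color fun _ _ h => Coloring.ext h

instance : Fintype (Coloring ℓ d) := Fintype.ofFinite _

/-- The groupoid whose objects are the colourings and whose arrows `f ⟶ g` are the permutations
`σ` with `g ∘ σ = f`; composition is composition of maps. -/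
instance : Groupoid.{0} (Coloring ℓ d) where
  Hom f g := {σ : Equiv.Perm (Fin d) // g.color ∘ σ = f.color}
  id f := ⟨1, rfl⟩
  comp σ τ := ⟨τ.1 * σ.1, by
    funext i
    exact (congrFun τ.2 (σ.1 i)).trans (congrFun σ.2 i)⟩
  inv {f g} σ := ⟨σ.1⁻¹, by
    funext i
    simpa using (congrFun σ.2 (σ.1⁻¹ i)).symm⟩
  id_comp σ := Subtype.ext (mul_one σ.1)
  comp_id σ := Subtype.ext (one_mul σ.1)
  assoc σ τ υ := Subtype.ext (mul_assoc υ.1 τ.1 σ.1).symm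
  inv_comp σ := Subtype.ext (mul_inv_cancel σ.1)
  comp_inv σ := Subtype.ext (inv_mul_cancel σ.1)

/-- The permutation underlying an arrow. -/
def perm {f g : Coloring ℓ d} (σ : f ⟶ g) : Equiv.Perm (Fin d) := σ.1

theorem color_comp_perm {f g : Coloring ℓ d} (σ : f ⟶ g) : g.color ∘ perm σ = f.color := σ.2

/-- The arrow given by a permutation. -/
def ofPerm {f g : Coloring ℓ d} (σ : Equiv.Perm (Fin d)) (h : g.color ∘ σ = f.color) : f ⟶ g :=
  ⟨σ, h⟩

instance (f g : Coloring ℓ d) : Finite (f ⟶ g) :=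
  inferInstanceAs (Finite {σ : Equiv.Perm (Fin d) // g.color ∘ σ = f.color})

instance (f g : Coloring ℓ d) : Fintype (f ⟶ g) := Fintype.ofFinite _

theorem perm_injective {f g : Coloring ℓ d} : Function.Injective (perm : (f ⟶ g) → _) :=
  Subtype.val_injective

theorem arrow_ext {x y : Arrows (Coloring ℓ d)} (h₁ : x.1 = y.1)
    (h₂ : perm x.2.2 = perm y.2.2) : x = y := by
  obtain ⟨f, g, σ⟩ := x
  obtain ⟨f', g', σ'⟩ := y
  dsimp only at h₁ h₂
  subst h₁
  have hg : g = g' := by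
    ext i
    have e₁ := congrFun (color_comp_perm σ) ((perm σ)⁻¹ i)
    have e₂ := congrFun (color_comp_perm σ') ((perm σ)⁻¹ i)
    rw [← h₂] at e₂
    simp only [Function.comp_apply] at e₁ e₂
    have e₃ : perm σ ((perm σ)⁻¹ i) = i := (perm σ).apply_symm_apply i
    rw [e₃] at e₁ e₂
    rw [e₁, e₂]
  subst hg
  rw [perm_injective h₂]

/-! ### The quotient groupoid -/

/-- The cyclic group generated by the `(ℓ / k)`-th power of the cycle `i ↦ i + 1` of the
`ℓ` colours. -/
abbrev colorRotations (ℓ k : ℕ) : Subgroup (Equiv.Perm (Fin ℓ)) :=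
  Subgroup.zpowers (finRotate ℓ ^ (ℓ / k))

instance : MulAction (colorRotations ℓ k) (Coloring ℓ d) where
  smul s f := ⟨s.1 ∘ f.color⟩
  one_smul _ := rfl
  mul_smul _ _ _ := rfl

theorem smul_color (s : colorRotations ℓ k) (f : Coloring ℓ d) :
    (s • f).color = s.1 ∘ f.color := rfl

/-- The group of rotations acts on all arrows: it changes the colours and fixes the underlying
permutation. -/
instance : MulAction (colorRotations ℓ k) (Arrows (Coloring ℓ d)) where
  smul s x := ⟨s • x.1, s • x.2.1, ofPerm (perm x.2.2) (by
    rw [smul_color, smul_color, Function.comp_assoc, color_comp_perm])⟩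
  one_smul _ := rfl
  mul_smul _ _ _ := rfl

theorem smul_arrow_fst (s : colorRotations ℓ k) (x : Arrows (Coloring ℓ d)) :
    (s • x).1 = s • x.1 := rfl
theorem smul_arrow_snd (s : colorRotations ℓ k) (x : Arrows (Coloring ℓ d)) :
    (s • x).2.1 = s • x.2.1 := rfl
theorem perm_smul_arrow (s : colorRotations ℓ k) (x : Arrows (Coloring ℓ d)) :
    perm (s • x).2.2 = perm x.2.2 := rfl

/-- Objects of the quotient groupoid: orbits of colourings. -/
def ColoringOrbit (ℓ k d : ℕ) : Type := MulAction.orbitRel.Quotient (colorRotations ℓ k) (Coloring ℓ d)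

/-- The orbit of a colouring. -/
def orb (k : ℕ) (f : Coloring ℓ d) : ColoringOrbit ℓ k d :=
  Quotient.mk (MulAction.orbitRel (colorRotations ℓ k) (Coloring ℓ d)) f

theorem orb_eq_iff {f g : Coloring ℓ d} :
    orb k f = orb k g ↔ ∃ s : colorRotations ℓ k, s • g = f :=
  Quotient.eq (r := MulAction.orbitRel (colorRotations ℓ k) (Coloring ℓ d))

theorem orb_smul (s : colorRotations ℓ k) (f : Coloring ℓ d) : orb k (s • f) = orb k f :=
  orb_eq_iff.2 ⟨s, rfl⟩

theorem orb_surjective : Function.Surjective (orb k : Coloring ℓ d → ColoringOrbit ℓ k d) :=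
  Quotient.mk_surjective

instance : Finite (ColoringOrbit ℓ k d) := Finite.of_surjective _ orb_surjective

instance : Fintype (ColoringOrbit ℓ k d) := Fintype.ofFinite _

/-- All arrows of the groupoid of colourings with source in the orbit `F` and target in the
orbit `G`. -/
abbrev ArrowsOver (F G : ColoringOrbit ℓ k d) : Type :=
  {x : Arrows (Coloring ℓ d) // orb k x.1 = F ∧ orb k x.2.1 = G}

/-- Two arrows are equivalent if they lie in one orbit of the group of rotations. -/
def arrowSetoid (F G : ColoringOrbit ℓ k d) : Setoid (ArrowsOver F G) :=
  (MulAction.orbitRel (colorRotations ℓ k) (Arrows (Coloring ℓ d))).comap Subtype.val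

/-- Arrows of the quotient groupoid: orbits of arrows. -/
def ArrowOrbit (F G : ColoringOrbit ℓ k d) : Type := Quotient (arrowSetoid F G)

/-- The orbit of an arrow whose source and target lie in given orbits. -/
def arrowOrb {F G : ColoringOrbit ℓ k d} (x : ArrowsOver F G) : ArrowOrbit F G :=
  Quotient.mk (arrowSetoid F G) x

theorem arrowOrb_surjective {F G : ColoringOrbit ℓ k d} :
    Function.Surjective (arrowOrb : ArrowsOver F G → ArrowOrbit F G) := Quotient.mk_surjective

theorem arrowOrb_eq {F G : ColoringOrbit ℓ k d} {x y : ArrowsOver F G}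
    (s : colorRotations ℓ k) (h₁ : s • y.1.1 = x.1.1) (h₂ : perm y.1.2.2 = perm x.1.2.2) :
    arrowOrb x = arrowOrb y :=
  Quotient.sound (s := arrowSetoid F G) ⟨s, arrow_ext h₁ h₂⟩

/-- Composition of an arrow `x : f ⟶ g` with an arrow `y : g' ⟶ h`, where `g'` lies in the orbit
of `g`: the arrow `y` is replaced by its translate with source `g`, which has the same underlying
permutation, and then composed with `x`. -/
def composeOver {F G K : ColoringOrbit ℓ k d} (x : ArrowsOver F G) (y : ArrowsOver G K) :
    ArrowsOver F K :=
  ⟨⟨x.1.1, ⟨x.1.2.1.color ∘ (perm y.1.2.2).symm⟩,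
      x.1.2.2 ≫ ofPerm (perm y.1.2.2) (by funext i; simp)⟩, x.2.1, by
    obtain ⟨s, hs⟩ := orb_eq_iff.1 (x.2.2.trans y.2.1.symm)
    refine Eq.trans (orb_eq_iff.2 ⟨s, ?_⟩) y.2.2
    ext1
    change _ = x.1.2.1.color ∘ _
    rw [smul_color, ← hs, smul_color, ← color_comp_perm y.1.2.2]
    funext i
    simp⟩

theorem perm_comp {f g h : Coloring ℓ d} (σ : f ⟶ g) (τ : g ⟶ h) :
    perm (σ ≫ τ) = perm τ * perm σ := rfl

theorem perm_ofPerm {f g : Coloring ℓ d} (σ : Equiv.Perm (Fin d))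
    (h : g.color ∘ σ = f.color) : perm (ofPerm σ h : f ⟶ g) = σ := rfl

theorem perm_composeOver {F G K : ColoringOrbit ℓ k d} (x : ArrowsOver F G)
    (y : ArrowsOver G K) : perm (composeOver x y).1.2.2 = perm y.1.2.2 * perm x.1.2.2 := rfl

/-- The quotient groupoid: its objects are orbits of colourings, its arrows are orbits of arrows,
with the induced composition (see `arrowOrb_comp`). -/
instance : Groupoid.{0} (ColoringOrbit ℓ k d) where
  Hom F G := ArrowOrbit F G
  id F := arrowOrb ⟨⟨F.out, F.out, 𝟙 _⟩, Quotient.out_eq _, Quotient.out_eq _⟩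
  comp {F G K} := Quotient.map₂ composeOver (by
    rintro x x' ⟨s, hs⟩ y y' ⟨t, ht⟩
    refine ⟨s, arrow_ext ?_ ?_⟩
    · change s • x'.1.1 = x.1.1
      rw [← hs]; rfl
    · have h₁ : perm x'.1.2.2 = perm x.1.2.2 := by rw [← hs]; rfl
      have h₂ : perm y'.1.2.2 = perm y.1.2.2 := by rw [← ht]; rfl
      change perm (composeOver x' y').1.2.2 = _
      rw [perm_composeOver, perm_composeOver, h₁, h₂])
  inv {F G} := Quotient.map
    (fun x => ⟨⟨x.1.2.1, x.1.1, Groupoid.inv x.1.2.2⟩, x.2.2, x.2.1⟩) (by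
    rintro x x' ⟨s, hs⟩
    refine ⟨s, arrow_ext ?_ ?_⟩
    · change s • x'.1.2.1 = x.1.2.1
      rw [← hs]; rfl
    · change (perm x'.1.2.2)⁻¹ = (perm x.1.2.2)⁻¹
      rw [← hs]; rfl)
  id_comp {F G} a := by
    obtain ⟨x, rfl⟩ := arrowOrb_surjective a
    obtain ⟨s, hs⟩ := orb_eq_iff.1 ((Quotient.out_eq F).trans x.2.1.symm)
    exact arrowOrb_eq s hs (mul_one _).symm
  comp_id {F G} a := by
    obtain ⟨x, rfl⟩ := arrowOrb_surjective a
    exact arrowOrb_eq 1 (one_smul _ _) (one_mul _).symm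
  assoc a b c := by
    obtain ⟨x, rfl⟩ := arrowOrb_surjective a
    obtain ⟨y, rfl⟩ := arrowOrb_surjective b
    obtain ⟨z, rfl⟩ := arrowOrb_surjective c
    exact arrowOrb_eq 1 (one_smul _ _) (mul_assoc _ _ _)
  inv_comp {F G} a := by
    obtain ⟨x, rfl⟩ := arrowOrb_surjective a
    obtain ⟨s, hs⟩ := orb_eq_iff.1 (x.2.2.trans (Quotient.out_eq G).symm)
    exact arrowOrb_eq s hs (mul_inv_cancel _).symm
  comp_inv {F G} a := by
    obtain ⟨x, rfl⟩ := arrowOrb_surjective a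
    obtain ⟨s, hs⟩ := orb_eq_iff.1 (x.2.1.trans (Quotient.out_eq F).symm)
    exact arrowOrb_eq s hs (inv_mul_cancel _).symm

/-- The arrow of the quotient groupoid given by the orbit of `σ : f ⟶ g`. -/
def arrowClass (k : ℕ) {f g : Coloring ℓ d} (σ : f ⟶ g) : orb k f ⟶ orb k g :=
  arrowOrb ⟨⟨f, g, σ⟩, rfl, rfl⟩

theorem arrowClass_id (f : Coloring ℓ d) : arrowClass k (𝟙 f) = 𝟙 (orb k f) := by
  obtain ⟨s, hs⟩ := orb_eq_iff.1 (Quotient.out_eq (orb k f)).symm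
  exact arrowOrb_eq s hs rfl

theorem arrowClass_comp {f g h : Coloring ℓ d} (σ : f ⟶ g) (τ : g ⟶ h) :
    arrowClass k (σ ≫ τ) = arrowClass k σ ≫ arrowClass k τ :=
  arrowOrb_eq 1 (one_smul _ _) rfl

theorem arrowClass_inv {f g : Coloring ℓ d} (σ : f ⟶ g) :
    arrowClass k (Groupoid.inv σ) = Groupoid.inv (arrowClass k σ) := rfl

instance (F G : ColoringOrbit ℓ k d) : Finite (F ⟶ G) :=
  Finite.of_surjective (arrowOrb : ArrowsOver F G → ArrowOrbit F G) arrowOrb_surjective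

instance (F G : ColoringOrbit ℓ k d) : Fintype (F ⟶ G) := Fintype.ofFinite _

/-- The algebra `A_(ℓ,d)` of the groupoid of colourings. -/
abbrev A (ℓ d : ℕ) : Type := GroupoidAlgebra (Coloring ℓ d)

/-- The algebra `A_(ℓ,k,d)` of the quotient groupoid. -/
abbrev AQuot (ℓ k d : ℕ) : Type := GroupoidAlgebra (ColoringOrbit ℓ k d)

def orbitPerm {F G : ColoringOrbit ℓ k d} : (F ⟶ G) → Equiv.Perm (Fin d) :=
  Quotient.lift (fun x : ArrowsOver F G => perm x.1.2.2) (by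
    rintro x x' ⟨s, hs⟩
    rw [← hs]; rfl)

theorem arrows_from_bijective (f : Coloring ℓ d) :
    Function.Bijective (fun p : (Σ g : Coloring ℓ d, (f ⟶ g)) =>
      (⟨orb k p.1, arrowClass k p.2⟩ : Σ G : ColoringOrbit ℓ k d, (orb k f ⟶ G))) := by
  constructor
  · rintro ⟨g, σ⟩ ⟨g', σ'⟩ h
    have hp : perm σ = perm σ' := congrArg
      (fun q : (Σ G : ColoringOrbit ℓ k d, (orb k f ⟶ G)) => orbitPerm q.2) h
    have := arrow_ext (x := ⟨f, g, σ⟩) (y := ⟨f, g', σ'⟩) rfl hp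
    simpa using this
  · rintro ⟨G, a⟩
    obtain ⟨⟨⟨f', g', σ⟩, hf, hg⟩, rfl⟩ := arrowOrb_surjective a
    obtain ⟨s, hs⟩ := orb_eq_iff.1 hf.symm
    dsimp only at hs hf hg
    subst hs
    have hg' : G = orb k (s • g') := by rw [orb_smul, hg]
    subst hg'
    refine ⟨⟨s • g', (s • (⟨f', g', σ⟩ : Arrows (Coloring ℓ d))).2.2⟩, ?_⟩
    refine congrArg (Sigma.mk _) ?_
    exact (arrowOrb_eq (F := orb k (s • f')) (G := orb k (s • g'))
      (x := ⟨s • (⟨f', g', σ⟩ : Arrows (Coloring ℓ d)), rfl, rfl⟩)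
      (y := ⟨⟨f', g', σ⟩, hf, hg⟩) s rfl rfl)

/-- The embedding of `A_(ℓ,k,d)` into `A_(ℓ,d)`, which sends the orbit of an arrow to the sum of
the arrows in this orbit: the coefficient of an arrow in the image of `a` is the coefficient of
its orbit in `a`. -/
def quotEmbedding (ℓ k d : ℕ) : AQuot ℓ k d →ₐ[ℂ] A ℓ d :=
  AlgHom.ofLinearMap
    { toFun := fun a => fun x => a ⟨orb k x.1, orb k x.2.1, arrowClass k x.2.2⟩
      map_add' := fun _ _ => rfl
      map_smul' := fun _ _ => rfl }
    (by
      classical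
      ext ⟨f, h, ρ⟩
      change (1 : AQuot ℓ k d) ⟨orb k f, orb k h, arrowClass k ρ⟩ = _
      rw [GroupoidAlgebra.one_apply, GroupoidAlgebra.one_apply]
      congr 1
      have hb := (arrows_from_bijective (k := k) f).1.eq_iff (a := ⟨h, ρ⟩) (b := ⟨f, 𝟙 f⟩)
      simp only [arrowClass_id] at hb
      simpa using hb)
    (by
      intro a b
      ext ⟨f, h, ρ⟩
      change (a * b) ⟨orb k f, orb k h, arrowClass k ρ⟩ = _
      rw [GroupoidAlgebra.mul_apply, GroupoidAlgebra.mul_apply, ← Fintype.sum_sigma',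
        ← Fintype.sum_sigma']
      symm
      refine Fintype.sum_bijective _ (arrows_from_bijective (k := k) f) _ _ ?_
      rintro ⟨g, σ⟩
      change a ⟨orb k g, orb k h, arrowClass k (Groupoid.inv σ ≫ ρ)⟩ *
        b ⟨orb k f, orb k g, arrowClass k σ⟩ = _
      rw [arrowClass_comp, arrowClass_inv])

/-! ### The action of the groupoid algebras on the tensor space -/

/-- The space `V = ℂ^(ℓm)`. The standard basis vector `v_{(c-1)m+r}` is the one indexed by
`(r, c)`: here `c` is the block (colour) and `r` the position inside the block. -/
abbrev V (ℓ m : ℕ) : Type := Fin m × Fin ℓ → ℂ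

/-- The tensor space `V^{⊗ d}`. -/
abbrev TensorSpace (ℓ m d : ℕ) : Type := ⨂[ℂ] _ : Fin d, V ℓ m

/-- The projection of `V = V_1 ⊕ ⋯ ⊕ V_ℓ` onto the block `V_c`. -/
def blockProj (m : ℕ) (c : Fin ℓ) : V ℓ m →ₗ[ℂ] V ℓ m where
  toFun w := fun p => if p.2 = c then w p else 0
  map_add' v w := by
    funext p
    by_cases h : p.2 = c <;> simp [h]
  map_smul' a w := by
    funext p
    by_cases h : p.2 = c <;> simp [h]

/-- The operator on `V^{⊗ d}` by which an arrow `σ : f ⟶ g` acts: on the summand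
`V_{f(1)} ⊗ ⋯ ⊗ V_{f(d)}` it is
`w_1 ⊗ ⋯ ⊗ w_d ↦ w_{σ⁻¹(1)} ⊗ ⋯ ⊗ w_{σ⁻¹(d)}`, and on the summands belonging to other colourings
it is zero. -/
def arrowOp (m : ℕ) {f g : Coloring ℓ d} (σ : f ⟶ g) : Module.End ℂ (TensorSpace ℓ m d) :=
  (PiTensorProduct.reindex ℂ (fun _ : Fin d => V ℓ m) (perm σ)).toLinearMap ∘ₗ
    PiTensorProduct.map (fun i => blockProj m (f.color i))

theorem arrowOp_tprod (m : ℕ) {f g : Coloring ℓ d} (σ : f ⟶ g) (w : Fin d → V ℓ m) :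
    arrowOp m σ (PiTensorProduct.tprod ℂ w) =
      PiTensorProduct.tprod ℂ (fun i =>
        blockProj m (f.color ((perm σ).symm i)) (w ((perm σ).symm i))) := by
  simp only [arrowOp, LinearMap.comp_apply, PiTensorProduct.map_tprod, LinearEquiv.coe_coe,
    PiTensorProduct.reindex_tprod]

theorem blockProj_blockProj (m : ℕ) (c c' : Fin ℓ) (w : V ℓ m) :
    blockProj m c (blockProj m c' w) = if c = c' then blockProj m c w else 0 := by
  funext p
  by_cases h : c = c'
  · subst h
    by_cases h' : p.2 = c <;> simp [blockProj, h']
  · by_cases h' : p.2 = c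
    · simp [blockProj, h, h']
    · simp [blockProj, h, h']

theorem arrowOp_mul (m : ℕ) {f g h : Coloring ℓ d} (σ : f ⟶ g) (τ : g ⟶ h) :
    arrowOp m τ * arrowOp m σ = arrowOp m (σ ≫ τ) := by
  refine PiTensorProduct.ext (MultilinearMap.ext fun w => ?_)
  change arrowOp m τ (arrowOp m σ (PiTensorProduct.tprod ℂ w)) =
    arrowOp m (σ ≫ τ) (PiTensorProduct.tprod ℂ w)
  rw [arrowOp_tprod, arrowOp_tprod, arrowOp_tprod]
  congr 1
  funext i
  have h₁ : (perm (σ ≫ τ)).symm i = (perm σ).symm ((perm τ).symm i) := rfl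
  have h₂ : g.color ((perm τ).symm i) = f.color ((perm σ).symm ((perm τ).symm i)) := by
    rw [← color_comp_perm σ]; simp
  rw [h₁, blockProj_blockProj, if_pos h₂, h₂]

theorem arrowOp_mul_eq_zero (m : ℕ) {f g g' h : Coloring ℓ d} (σ : f ⟶ g) (τ : g' ⟶ h)
    (hg : g ≠ g') : arrowOp m τ * arrowOp m σ = 0 := by
  refine PiTensorProduct.ext (MultilinearMap.ext fun w => ?_)
  change arrowOp m τ (arrowOp m σ (PiTensorProduct.tprod ℂ w)) = 0
  rw [arrowOp_tprod, arrowOp_tprod]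
  obtain ⟨j, hj⟩ : ∃ j, g'.color j ≠ g.color j := by
    by_contra hc
    push Not at hc
    exact hg (Coloring.ext (funext fun j => (hc j).symm))
  refine (PiTensorProduct.tprod ℂ).map_coord_zero (perm τ j) ?_
  rw [Equiv.symm_apply_apply, blockProj_blockProj, if_neg]
  rw [← color_comp_perm σ]
  simpa using hj

theorem sum_arrowOp_id (m : ℕ) :
    ∑ f : Coloring ℓ d, arrowOp m (𝟙 f) = 1 := by
  classical
  refine PiTensorProduct.ext (MultilinearMap.ext fun w => ?_)
  change (∑ f : Coloring ℓ d, arrowOp m (𝟙 f)) (PiTensorProduct.tprod ℂ w) =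
    PiTensorProduct.tprod ℂ w
  rw [LinearMap.sum_apply]
  have hw : w = fun i => ∑ c : Fin ℓ, blockProj m c (w i) := by
    funext i p
    simp [blockProj, Finset.sum_apply]
  conv_rhs => rw [hw, MultilinearMap.map_sum]
  refine Fintype.sum_bijective Coloring.color
    ⟨fun _ _ h => Coloring.ext h, fun f => ⟨⟨f⟩, rfl⟩⟩ _ _ fun f => ?_
  rw [arrowOp_tprod]
  rfl

/-- The action of `A_(ℓ,d)` on `V^{⊗ d}`. -/
def algebraAction (ℓ m d : ℕ) : A ℓ d →ₐ[ℂ] Module.End ℂ (TensorSpace ℓ m d) :=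
  AlgHom.ofLinearMap
    { toFun := fun a => ∑ f : Coloring ℓ d, ∑ g : Coloring ℓ d, ∑ σ : (f ⟶ g),
        a ⟨f, g, σ⟩ • arrowOp m σ
      map_add' := fun a b => by
        simp only [GroupoidAlgebra.add_apply, add_smul, Finset.sum_add_distrib]
      map_smul' := fun c a => by
        simp only [GroupoidAlgebra.smul_apply, mul_smul, Finset.smul_sum, RingHom.id_apply] }
    (by
      classical
      rw [← sum_arrowOp_id]
      refine Finset.sum_congr rfl fun f _ => ?_
      rw [Finset.sum_eq_single f, Finset.sum_eq_single (𝟙 f)]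
      · rw [GroupoidAlgebra.one_apply, if_pos rfl, one_smul]
      · intro σ _ hσ
        rw [GroupoidAlgebra.one_apply, if_neg, zero_smul]
        intro h
        exact hσ (by simpa using h)
      · simp
      · intro g _ hg
        refine Finset.sum_eq_zero fun σ _ => ?_
        rw [GroupoidAlgebra.one_apply, if_neg, zero_smul]
        intro h
        exact hg (congrArg (fun x : Arrows (Coloring ℓ d) => x.2.1) h)
      · simp)
    (by
      intro a b
      change (∑ f : Coloring ℓ d, ∑ h : Coloring ℓ d, ∑ ρ : (f ⟶ h),
          (a * b) ⟨f, h, ρ⟩ • arrowOp m ρ) =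
        (∑ f : Coloring ℓ d, ∑ g : Coloring ℓ d, ∑ σ : (f ⟶ g), a ⟨f, g, σ⟩ • arrowOp m σ) *
        (∑ f : Coloring ℓ d, ∑ g : Coloring ℓ d, ∑ σ : (f ⟶ g), b ⟨f, g, σ⟩ • arrowOp m σ)
      have hR : (∑ f : Coloring ℓ d, ∑ g : Coloring ℓ d, ∑ σ : (f ⟶ g),
            a ⟨f, g, σ⟩ • arrowOp m σ) *
          (∑ f : Coloring ℓ d, ∑ g : Coloring ℓ d, ∑ σ : (f ⟶ g), b ⟨f, g, σ⟩ • arrowOp m σ) =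
          ∑ f : Coloring ℓ d, ∑ g : Coloring ℓ d, ∑ σ : (f ⟶ g), ∑ h : Coloring ℓ d,
            ∑ τ : (g ⟶ h), (a ⟨g, h, τ⟩ * b ⟨f, g, σ⟩) • arrowOp m (σ ≫ τ) := by
        rw [Finset.mul_sum]
        refine Finset.sum_congr rfl fun f _ => ?_
        rw [Finset.mul_sum]
        refine Finset.sum_congr rfl fun g _ => ?_
        rw [Finset.mul_sum]
        refine Finset.sum_congr rfl fun σ _ => ?_
        rw [Finset.sum_mul, Finset.sum_eq_single g]
        · rw [Finset.sum_mul]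
          refine Finset.sum_congr rfl fun h _ => ?_
          rw [Finset.sum_mul]
          refine Finset.sum_congr rfl fun τ _ => ?_
          rw [smul_mul_smul_comm, arrowOp_mul]
        · intro g' _ hg'
          rw [Finset.sum_mul]
          refine Finset.sum_eq_zero fun h _ => ?_
          rw [Finset.sum_mul]
          refine Finset.sum_eq_zero fun τ _ => ?_
          rw [smul_mul_smul_comm, arrowOp_mul_eq_zero m σ τ hg'.symm, smul_zero]
        · simp
      rw [hR]
      refine Finset.sum_congr rfl fun f _ => ?_
      simp only [GroupoidAlgebra.mul_apply, Finset.sum_smul]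
      rw [Finset.sum_congr rfl fun h _ => Finset.sum_comm]
      rw [Finset.sum_comm]
      refine Finset.sum_congr rfl fun g _ => ?_
      rw [Finset.sum_congr rfl fun h _ => Finset.sum_comm]
      rw [Finset.sum_comm]
      refine Finset.sum_congr rfl fun σ _ => ?_
      refine Finset.sum_congr rfl fun h _ => ?_
      refine Fintype.sum_equiv
        ⟨fun ρ => Groupoid.inv σ ≫ ρ, fun τ => σ ≫ τ, fun ρ => by simp, fun τ => by simp⟩ _ _ ?_
      intro ρ
      simp)

/-- The restricted action of `A_(ℓ,k,d)` on `V^{⊗ d}`. -/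
def quotAction (ℓ k m d : ℕ) : AQuot ℓ k d →ₐ[ℂ] Module.End ℂ (TensorSpace ℓ m d) :=
  (algebraAction ℓ m d).comp (quotEmbedding ℓ k d)

/-! ### The action of the free product -/

/-- The free product of `GL_m × ⋯ × GL_m` (`ℓ` factors) and `ℤ`. -/
abbrev FreeProd (ℓ m : ℕ) : Type :=
  Monoid.Coprod (Fin ℓ → GL (Fin m) ℂ) (Multiplicative ℤ)

/-- The action of `GL_m × ⋯ × GL_m` on `V` by block-diagonal matrices. -/
def blockRep (ℓ m : ℕ) : Representation ℂ (Fin ℓ → GL (Fin m) ℂ) (V ℓ m) where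
  toFun x := Matrix.toLin' (Matrix.blockDiagonal fun c => (x c : Matrix (Fin m) (Fin m) ℂ))
  map_one' := by
    have : (fun c : Fin ℓ => (((1 : Fin ℓ → GL (Fin m) ℂ) c : GL (Fin m) ℂ) :
        Matrix (Fin m) (Fin m) ℂ)) = 1 := rfl
    rw [this, Matrix.blockDiagonal_one, Matrix.toLin'_one]
    rfl
  map_mul' x y := by
    have : (fun c : Fin ℓ => (((x * y) c : GL (Fin m) ℂ) : Matrix (Fin m) (Fin m) ℂ)) =
        fun c => (x c : Matrix (Fin m) (Fin m) ℂ) * (y c : Matrix (Fin m) (Fin m) ℂ) := rfl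
    rw [this, Matrix.blockDiagonal_mul, Matrix.toLin'_mul]
    rfl

/-- The cyclic shift of the basis of `V` by `ℓ / k` blocks, that is
`v_i ↦ v_{i + (ℓ/k) m}` with indices modulo `ℓ m` (see `blockShift_single`). -/
def blockShift (ℓ k m : ℕ) : V ℓ m ≃ₗ[ℂ] V ℓ m :=
  LinearEquiv.funCongrLeft ℂ ℂ
    ((Equiv.refl (Fin m)).prodCongr (finRotate ℓ ^ (ℓ / k)).symm)

theorem blockShift_single (ℓ k m : ℕ) (r : Fin m) (c : Fin ℓ) :
    blockShift ℓ k m (Pi.single (r, c) 1) = Pi.single (r, (finRotate ℓ ^ (ℓ / k)) c) 1 := by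
  funext p
  change (Pi.single (r, c) 1 : V ℓ m) (p.1, (finRotate ℓ ^ (ℓ / k)).symm p.2) = _
  simp only [Pi.single_apply, Prod.ext_iff, Equiv.symm_apply_eq]

/-- The action of the free product on `V`; the generator of `ℤ` acts by the cyclic shift. -/
def freeProdRep (ℓ k m : ℕ) : Representation ℂ (FreeProd ℓ m) (V ℓ m) :=
  Monoid.Coprod.lift (blockRep ℓ m)
    ((LinearEquiv.automorphismGroup.toLinearMapMonoidHom).comp
      (zpowersHom (V ℓ m ≃ₗ[ℂ] V ℓ m) (blockShift ℓ k m)))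

/-- The diagonal action of the free product on `V^{⊗ d}`. -/
def freeProdTensorRep (ℓ k m d : ℕ) : Representation ℂ (FreeProd ℓ m) (TensorSpace ℓ m d) where
  toFun x := PiTensorProduct.map fun _ => freeProdRep ℓ k m x
  map_one' := by
    rw [map_one]
    exact PiTensorProduct.map_one
  map_mul' x y := by
    rw [map_mul]
    exact PiTensorProduct.map_mul _ _

/-! ### The complex reflection group `G(ℓ,k,d)` -/

/-- The monomial matrix with entry `z j` at position `(σ j, j)` and zeros elsewhere. -/
def monomialMatrix (σ : Equiv.Perm (Fin d)) (z : Fin d → ℂ) : Matrix (Fin d) (Fin d) ℂ :=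
  Matrix.of fun i j => if i = σ j then z j else 0

theorem monomialMatrix_mul (σ τ : Equiv.Perm (Fin d)) (z w : Fin d → ℂ) :
    monomialMatrix σ z * monomialMatrix τ w =
      monomialMatrix (σ * τ) (fun j => z (τ j) * w j) := by
  ext i j
  simp only [monomialMatrix, Matrix.mul_apply, Matrix.of_apply, Equiv.Perm.mul_apply, mul_ite,
    mul_zero, Finset.sum_ite_eq', Finset.sum_ite_eq, Finset.mem_univ, if_true, ite_mul, zero_mul]
  congr

theorem monomialMatrix_one : monomialMatrix (1 : Equiv.Perm (Fin d)) 1 = 1 := by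
  ext i j
  simp [monomialMatrix, Matrix.one_apply]
  congr

/-- The complex reflection group `G(ℓ,k,d)`: monomial `d × d` matrices whose nonzero entries are
`ℓ`-th roots of unity (for `ℓ > 0` the clause `z j ≠ 0` is automatic) and the product of the
nonzero entries is an `(ℓ / k)`-th root of unity. -/
def reflectionGroup (ℓ k d : ℕ) : Subgroup (GL (Fin d) ℂ) where
  carrier := {X | ∃ (σ : Equiv.Perm (Fin d)) (z : Fin d → ℂ),
    (∀ j, z j ^ ℓ = 1 ∧ z j ≠ 0) ∧ (∏ j, z j) ^ (ℓ / k) = 1 ∧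
      (X : Matrix (Fin d) (Fin d) ℂ) = monomialMatrix σ z}
  mul_mem' := by
    rintro X Y ⟨σ, z, hz, hz', hX⟩ ⟨τ, w, hw, hw', hY⟩
    refine ⟨σ * τ, fun j => z (τ j) * w j, fun j => ⟨?_, mul_ne_zero (hz _).2 (hw j).2⟩, ?_, ?_⟩
    · rw [mul_pow, (hz _).1, (hw j).1, one_mul]
    · rw [Finset.prod_mul_distrib, Equiv.prod_comp τ z, mul_pow, hz', hw', one_mul]
    · rw [Units.val_mul, hX, hY, monomialMatrix_mul]
  one_mem' := ⟨1, 1, fun _ => ⟨one_pow _, one_ne_zero⟩, by simp, monomialMatrix_one.symm⟩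
  inv_mem' := by
    rintro X ⟨σ, z, hz, hz', hX⟩
    refine ⟨σ⁻¹, fun j => (z (σ⁻¹ j))⁻¹, fun j => ⟨?_, inv_ne_zero (hz _).2⟩, ?_, ?_⟩
    · rw [inv_pow, (hz _).1, inv_one]
    · rw [Equiv.prod_comp σ⁻¹ (fun j => (z j)⁻¹), Finset.prod_inv_distrib, inv_pow, hz', inv_one]
    · have h : monomialMatrix σ⁻¹ (fun j => (z (σ⁻¹ j))⁻¹) * (X : Matrix (Fin d) (Fin d) ℂ) = 1 := by
        rw [hX, monomialMatrix_mul, inv_mul_cancel, ← monomialMatrix_one]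
        congr 1
        funext j
        have e : σ⁻¹ (σ j) = j := σ.symm_apply_apply j
        rw [e, inv_mul_cancel₀ (hz j).2, Pi.one_apply]
      calc ((X⁻¹ : GL (Fin d) ℂ) : Matrix (Fin d) (Fin d) ℂ)
          = (monomialMatrix σ⁻¹ (fun j => (z (σ⁻¹ j))⁻¹) * (X : Matrix (Fin d) (Fin d) ℂ)) *
            ((X⁻¹ : GL (Fin d) ℂ) : Matrix (Fin d) (Fin d) ℂ) := by rw [h, one_mul]
        _ = _ := by rw [mul_assoc, ← Units.val_mul, mul_inv_cancel, Units.val_one, mul_one]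

open Classical in
/-- The element of `A_(ℓ,d)` attached to a monomial matrix, namely the sum over all colourings `f`
of the arrow `σ : f ⟶ f ∘ σ⁻¹` with coefficient `∏ j, z_j ^ f(j)`. Here the colours are numbered
`1, …, ℓ`. -/
def monomialElement (ℓ : ℕ) (σ : Equiv.Perm (Fin d)) (z : Fin d → ℂ) : A ℓ d :=
  fun x => if perm x.2.2 = σ then ∏ j, z j ^ ((x.1.color j : ℕ) + 1) else 0

end ColorGroupoid
end

/-! The basis of `V^{⊗d}` consists of the tensors `e_I` of standard basis vectors, where `I` is a
multi-index with a colouring. An arrow of the groupoid sends `e_I` to `e_{I ∘ σ⁻¹}` or to zero, and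
the image of `Ψ` in `A_(ℓ,d)` is exactly the set of rotation-invariant elements
(`mem_range_quotEmbedding_iff`).

Operators commuting with the group. Since `B` is invertible at all but finitely many points of a
line `B + t·1`, such an operator `T` commutes with `B ⊗ ⋯ ⊗ B` for every block-diagonal `B`,
singular ones included. As `d ≤ m`, each colouring `f` carries a multi-index with pairwise distinct
positions. Diagonal `B` force `T` to send its basis vector to a combination of rearrangements of it,
so `T` agrees there with some `b` in `A_(ℓ,d)`. Block-diagonal operators carry this vector to every
`e_I` of colouring `f`, so `T` is the action of `b` everywhere. Commuting with the shift makes `b`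
rotation-invariant.

Operators commuting with the algebra. Place permutations and the projections onto orbits of
colourings both lie in the image of `A_(ℓ,k,d)`. Hence the matrix coefficients of `T` are invariant
under simultaneous permutation of places, and vanish unless one rotation carries the colours of `I`
to those of `J`. After averaging over `S_d`, `T` is a combination of symmetrized tensor products of
matrix units, and polarization writes these through operators `(shift^i B)^{⊗d}` with `B`
block-diagonal.

The group algebra. The elements attached to monomial matrices multiply like the matrices. By
independence of characters and a dimension count, those whose entries are `ℓ`-th roots of unity form
a basis of `A_(ℓ,d)`. The generating rotation is diagonal in this basis, with eigenvalue `(∏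
z_j)^(ℓ/k)`, so its invariants are spanned by the elements coming from `G(ℓ,k,d)`. -/

noncomputable section
-- Polarization and diagonal values of multilinear maps.
namespace MultilinearMap

variable {ι K E F : Type*} [Fintype ι] [Field K] [AddCommGroup E] [Module K E]
  [AddCommGroup F] [Module K F]

/-- Polarization identity, in terms of the values on the diagonal. -/
theorem sum_perm_eq_sum_neg_one_pow [DecidableEq ι] (f : MultilinearMap K (fun _ : ι => E) F)
    (A : ι → E) :
    ∑ σ : Equiv.Perm ι, f (fun j => A (σ j)) =
      ∑ s : Finset ι, (-1 : K) ^ (sᶜ).card • f (fun _ => ∑ j ∈ s, A j) := by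
  have expand : ∀ s : Finset ι, f (fun _ => ∑ j ∈ s, A j) =
      ∑ r : ι → ι, if ∀ i, r i ∈ s then f (fun i => A (r i)) else 0 := by
    intro s
    rw [f.map_sum_finset (fun _ j => A j) (fun _ => s), ← Finset.sum_filter]
    refine Finset.sum_congr ?_ fun _ _ => rfl
    ext r
    simp
  simp_rw [expand, Finset.smul_sum]
  rw [Finset.sum_comm]
  have inner : ∀ r : ι → ι, (∑ s : Finset ι, (-1 : K) ^ (sᶜ).card •
      (if ∀ i, r i ∈ s then f (fun i => A (r i)) else 0)) =
      if Function.Bijective r then f (fun i => A (r i)) else 0 := by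
    intro r
    split_ifs with hr
    · rw [Finset.sum_eq_single Finset.univ]
      · simp
      · intro s _ hs
        rw [if_neg, smul_zero]
        intro h
        refine hs (Finset.eq_univ_of_forall fun i => ?_)
        obtain ⟨j, rfl⟩ := hr.2 i
        exact h j
      · simp
    · have hns : ¬ Function.Surjective r := fun h =>
        hr (Finite.surjective_iff_bijective.1 h)
      simp only [Function.Surjective, not_forall, not_exists] at hns
      obtain ⟨j, hj⟩ := hns
      -- The map `r` misses `j`, so adding `j` to `s` or removing it keeps the condition and flips
      -- the sign: the terms cancel in pairs.
      have hmem : ∀ s : Finset ι, (∀ i, r i ∈ symmDiff s {j}) ↔ ∀ i, r i ∈ s := by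
        intro s
        refine forall_congr' fun i => ?_
        simp [Finset.mem_symmDiff, hj i]
      refine Finset.sum_involution (fun s _ => symmDiff s {j}) ?_ ?_ ?_ ?_
      · intro s _
        rw [if_congr (hmem s) rfl rfl]
        by_cases hjs : j ∈ s
        · have e : (symmDiff s {j})ᶜ = insert j sᶜ := by
            ext x
            by_cases hx : x = j <;> simp [hx, hjs]
          rw [e, Finset.card_insert_of_notMem (by simpa using hjs), pow_succ,
            mul_neg_one, neg_smul]
          exact add_neg_cancel _
        · have e : sᶜ = insert j (symmDiff s {j})ᶜ := by
            ext x
            by_cases hx : x = j <;> simp [hx, hjs]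
          rw [e, Finset.card_insert_of_notMem (by simp [hjs]), pow_succ,
            mul_neg_one, neg_smul]
          exact neg_add_cancel _
      · intro s _ _ h
        have := congrArg (fun t => j ∈ t) h
        simp [Finset.mem_symmDiff] at this
      · simp
      · intro s _
        simp
  simp_rw [inner]
  rw [← Finset.sum_filter]
  refine Finset.sum_bij (fun σ _ => σ) (fun σ _ => by simp)
    (fun _ _ _ _ h => DFunLike.coe_injective h) ?_ (fun _ _ => rfl)
  intro r hr
  exact ⟨Equiv.ofBijective r (by simpa using hr), Finset.mem_univ _, rfl⟩

/-- This is how symmetrized tensors of matrix units are reached from operators of the form `B ⊗ ⋯ ⊗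
B`. -/
theorem sum_perm_mem [DecidableEq ι] (f : MultilinearMap K (fun _ : ι => E) F)
    (A : ι → E) (S : Submodule K F) (h : ∀ s : Finset ι, f (fun _ => ∑ j ∈ s, A j) ∈ S) :
    ∑ σ : Equiv.Perm ι, f (fun j => A (σ j)) ∈ S := by
  rw [sum_perm_eq_sum_neg_one_pow]
  exact S.sum_mem fun s _ => S.smul_mem _ (h s)

/-- If the values of a multilinear map on the diagonal lie in a subspace for infinitely many points
of a line, then they do so for all points of the line. -/
theorem diag_mem_of_infinite (f : MultilinearMap K (fun _ : ι => E) F) (B C : E)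
    (S : Submodule K F) (h : {t : K | f (fun _ => B + t • C) ∈ S}.Infinite) :
    f (fun _ => B) ∈ S := by
  classical
  by_contra hB
  obtain ⟨φ, hφ, hS⟩ := Submodule.exists_le_ker_of_notMem hB
  -- A functional that vanishes on `S` but not at the value on `B` turns the diagonal values along
  -- the line into a polynomial in `t`. It has infinitely many roots, hence is zero, which
  -- contradicts its value at `t = 0`.
  obtain ⟨P, hP⟩ : ∃ P : Polynomial K, ∀ t : K, P.eval t = φ (f (fun _ => B + t • C)) := by
    refine ⟨∑ s : Finset ι,
      Polynomial.C (φ (f (s.piecewise (fun _ => C) (fun _ => B)))) * Polynomial.X ^ s.card,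
      fun t => ?_⟩
    have e : (fun _ : ι => B + t • C) = (fun _ => t • C) + fun _ => B := by
      funext; simp [add_comm]
    rw [e, f.map_add_univ, _root_.map_sum, Polynomial.eval_finsetSum]
    refine Finset.sum_congr rfl fun s _ => ?_
    have e' : s.piecewise (fun _ : ι => t • C) (fun _ => B) =
        s.piecewise (fun i => t • (s.piecewise (fun _ => C) (fun _ => B)) i)
          (s.piecewise (fun _ => C) (fun _ => B)) := by
      funext i
      by_cases hi : i ∈ s <;> simp [hi]
    rw [e', f.map_piecewise_smul (fun _ => t), Finset.prod_const, _root_.map_smul, smul_eq_mul,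
      Polynomial.eval_mul, Polynomial.eval_C, Polynomial.eval_pow, Polynomial.eval_X, mul_comm]
  have h0 : P = 0 := by
    refine Polynomial.eq_zero_of_infinite_isRoot P (h.mono fun t ht => ?_)
    change P.eval t = 0
    rw [hP]
    exact hS ht
  have := hP 0
  rw [h0, Polynomial.eval_zero] at this
  simp only [zero_smul, add_zero] at this
  exact hφ this.symm

end MultilinearMap
end

noncomputable section
namespace ColorGroupoid

variable {ℓ k d m : ℕ}

/-! ### Arrows as pairs of a colouring and a permutation -/

/-- The arrow with source `f` and underlying permutation `σ`. -/
def arrowMk (f : Coloring ℓ d) (σ : Equiv.Perm (Fin d)) : Arrows (Coloring ℓ d) :=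
  ⟨f, ⟨f.color ∘ σ.symm⟩, ofPerm σ (by funext i; simp)⟩

theorem arrowMk_fst_perm (x : Arrows (Coloring ℓ d)) : arrowMk x.1 (perm x.2.2) = x :=
  arrow_ext rfl rfl

/-- An arrow is determined by its source and its underlying permutation. -/
def arrowEquiv (ℓ d : ℕ) : Coloring ℓ d × Equiv.Perm (Fin d) ≃ Arrows (Coloring ℓ d) where
  toFun p := arrowMk p.1 p.2
  invFun x := (x.1, perm x.2.2)
  left_inv _ := rfl
  right_inv x := arrowMk_fst_perm x

theorem smul_arrowMk (s : colorRotations ℓ k) (f : Coloring ℓ d) (σ : Equiv.Perm (Fin d)) :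
    s • arrowMk f σ = arrowMk (s • f) σ :=
  arrow_ext rfl rfl

theorem sum_arrows {M : Type*} [AddCommMonoid M] (F : Arrows (Coloring ℓ d) → M) :
    ∑ f : Coloring ℓ d, ∑ g : Coloring ℓ d, ∑ σ : (f ⟶ g), F ⟨f, g, σ⟩ =
      ∑ f : Coloring ℓ d, ∑ σ : Equiv.Perm (Fin d), F (arrowMk f σ) := by
  have h := Fintype.sum_equiv (arrowEquiv ℓ d) (fun p => F (arrowMk p.1 p.2)) F fun _ => rfl
  rw [Fintype.sum_prod_type] at h
  rw [h, Fintype.sum_sigma]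
  refine Finset.sum_congr rfl fun f _ => ?_
  rw [Fintype.sum_sigma]

theorem quotEmbedding_apply (a : AQuot ℓ k d) (x : Arrows (Coloring ℓ d)) :
    quotEmbedding ℓ k d a x = a ⟨orb k x.1, orb k x.2.1, arrowClass k x.2.2⟩ := rfl

theorem arrowClass_smul (s : colorRotations ℓ k) (x : Arrows (Coloring ℓ d)) :
    (⟨orb k (s • x).1, orb k (s • x).2.1, arrowClass k (s • x).2.2⟩ :
      Arrows (ColoringOrbit ℓ k d)) = ⟨orb k x.1, orb k x.2.1, arrowClass k x.2.2⟩ := by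
  -- The two classes lie in hom-sets whose endpoints agree only through `orb_smul`; with variable
  -- endpoints the equalities can be substituted.
  have h : ∀ (F G : ColoringOrbit ℓ k d) (hF : orb k x.1 = F) (hG : orb k x.2.1 = G)
      (y : ArrowOrbit F G), y = arrowOrb ⟨x, hF, hG⟩ →
      (⟨F, G, y⟩ : Arrows (ColoringOrbit ℓ k d)) =
        ⟨orb k x.1, orb k x.2.1, arrowClass k x.2.2⟩ := by
    rintro F G rfl rfl y rfl
    rfl
  refine h _ _ (orb_smul s x.1).symm (orb_smul s x.2.1).symm _ ?_
  exact arrowOrb_eq s rfl rfl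

theorem arrowClass_eq_imp {x y : Arrows (Coloring ℓ d)}
    (h : (⟨orb k x.1, orb k x.2.1, arrowClass k x.2.2⟩ : Arrows (ColoringOrbit ℓ k d)) =
      ⟨orb k y.1, orb k y.2.1, arrowClass k y.2.2⟩) :
    ∃ s : colorRotations ℓ k, s • y = x := by
  obtain ⟨s, hs⟩ := orb_eq_iff.1 (congrArg (fun z : Arrows (ColoringOrbit ℓ k d) => z.1) h)
  exact ⟨s, arrow_ext hs (congrArg
    (fun z : Arrows (ColoringOrbit ℓ k d) => orbitPerm z.2.2) h).symm⟩

theorem arrowClass_surjective (y : Arrows (ColoringOrbit ℓ k d)) :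
    ∃ x : Arrows (Coloring ℓ d),
      (⟨orb k x.1, orb k x.2.1, arrowClass k x.2.2⟩ : Arrows (ColoringOrbit ℓ k d)) = y := by
  obtain ⟨F, G, a⟩ := y
  obtain ⟨⟨x, rfl, rfl⟩, rfl⟩ := arrowOrb_surjective a
  exact ⟨x, rfl⟩

theorem quotEmbedding_injective : Function.Injective (quotEmbedding ℓ k d) := by
  intro a b h
  ext y
  obtain ⟨x, rfl⟩ := arrowClass_surjective y
  exact congrFun h x

/-- The image of `A_(ℓ,k,d)` in `A_(ℓ,d)` consists of the invariants of the rotations. -/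
theorem mem_range_quotEmbedding_iff (b : A ℓ d) :
    (∃ a, quotEmbedding ℓ k d a = b) ↔
      ∀ (s : colorRotations ℓ k) (x : Arrows (Coloring ℓ d)), b (s • x) = b x := by
  constructor
  · rintro ⟨a, rfl⟩ s x
    rw [quotEmbedding_apply, quotEmbedding_apply, arrowClass_smul]
  · intro h
    -- The coefficient of an orbit is read at a chosen representative; invariance of `b` makes the
    -- choice immaterial.
    refine ⟨fun y => b (arrowClass_surjective y).choose, ?_⟩
    ext x
    obtain ⟨s, hs⟩ := arrowClass_eq_imp (arrowClass_surjective
      (⟨orb k x.1, orb k x.2.1, arrowClass k x.2.2⟩ : Arrows (ColoringOrbit ℓ k d))).choose_spec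
    change b (arrowClass_surjective
      (⟨orb k x.1, orb k x.2.1, arrowClass k x.2.2⟩ : Arrows (ColoringOrbit ℓ k d))).choose = b x
    rw [← hs, h]

theorem rotation_invariant_of_generator {X M : Type*} [MulAction (colorRotations ℓ k) X]
    (b : X → M)
    (h : ∀ x, b ((⟨finRotate ℓ ^ (ℓ / k), Subgroup.mem_zpowers _⟩ : colorRotations ℓ k) • x) = b x)
    (s : colorRotations ℓ k) (x : X) : b (s • x) = b x := by
  obtain ⟨s, i, rfl⟩ := s
  have e : (⟨(finRotate ℓ ^ (ℓ / k)) ^ i, ⟨i, rfl⟩⟩ : colorRotations ℓ k) =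
      (⟨finRotate ℓ ^ (ℓ / k), Subgroup.mem_zpowers _⟩ : colorRotations ℓ k) ^ i :=
    Subtype.ext (by simp)
  change b ((⟨(finRotate ℓ ^ (ℓ / k)) ^ i, ⟨i, rfl⟩⟩ : colorRotations ℓ k) • x) = b x
  rw [e]
  clear e
  generalize (⟨finRotate ℓ ^ (ℓ / k), Subgroup.mem_zpowers _⟩ : colorRotations ℓ k) = g at h
  induction i generalizing x with
  | zero => simp
  | succ i ih =>
    rw [zpow_add_one, mul_smul, ih, h]
  | pred i ih =>
    rw [zpow_sub_one, mul_smul, ih, ← h, smul_inv_smul]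

/-! ### The standard basis of the tensor space -/

/-- The basis of `V^{⊗ d}` given by the tensor products of the standard basis vectors. -/
def tensorBasis (ℓ m d : ℕ) :
    Module.Basis (Fin d → Fin m × Fin ℓ) ℂ (TensorSpace ℓ m d) :=
  Basis.piTensorProduct fun _ => Pi.basisFun ℂ _

theorem tensorBasis_apply (I : Fin d → Fin m × Fin ℓ) :
    tensorBasis ℓ m d I = PiTensorProduct.tprod ℂ fun j => Pi.single (I j) 1 := by
  simp [tensorBasis]

/-- The colouring of a basis vector. -/
def coloring (I : Fin d → Fin m × Fin ℓ) : Coloring ℓ d := ⟨fun j => (I j).2⟩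

theorem blockProj_single (c : Fin ℓ) (p : Fin m × Fin ℓ) :
    blockProj m c (Pi.single p 1) = if p.2 = c then Pi.single p 1 else 0 := by
  funext q
  by_cases hq : q = p
  · subst hq
    by_cases h : q.2 = c <;> simp [blockProj, h]
  · by_cases h : p.2 = c <;> by_cases h' : q.2 = c <;> simp [blockProj, h, h', hq]

open Classical in
theorem arrowOp_tensorBasis (I : Fin d → Fin m × Fin ℓ) (x : Arrows (Coloring ℓ d)) :
    arrowOp m x.2.2 (tensorBasis ℓ m d I) =
      if x.1 = coloring I then tensorBasis ℓ m d (I ∘ (perm x.2.2).symm) else 0 := by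
  rw [tensorBasis_apply, arrowOp_tprod]
  simp_rw [blockProj_single]
  split_ifs with h
  · rw [tensorBasis_apply]
    congr 1
    funext i
    exact if_pos (congrFun (congrArg Coloring.color h.symm) _)
  · obtain ⟨j, hj⟩ : ∃ j, (I j).2 ≠ x.1.color j := by
      by_contra hc
      push Not at hc
      exact h (Coloring.ext (funext fun j => (hc j).symm))
    refine (PiTensorProduct.tprod ℂ).map_coord_zero (perm x.2.2 j) ?_
    rw [Equiv.symm_apply_apply, if_neg hj]

theorem algebraAction_apply (a : A ℓ d) :
    algebraAction ℓ m d a = ∑ f : Coloring ℓ d, ∑ g : Coloring ℓ d, ∑ σ : (f ⟶ g),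
        a ⟨f, g, σ⟩ • arrowOp m σ := rfl

/-- Only arrows whose source is the colouring of `I` survive, and such an arrow is determined by its
permutation. -/
theorem algebraAction_tensorBasis (a : A ℓ d) (I : Fin d → Fin m × Fin ℓ) :
    algebraAction ℓ m d a (tensorBasis ℓ m d I) =
      ∑ σ : Equiv.Perm (Fin d), a (arrowMk (coloring I) σ) • tensorBasis ℓ m d (I ∘ σ.symm) := by
  classical
  rw [algebraAction_apply, sum_arrows (fun x => a x • arrowOp m x.2.2), LinearMap.sum_apply,
    Finset.sum_eq_single (coloring I)]
  · rw [LinearMap.sum_apply]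
    refine Finset.sum_congr rfl fun σ _ => ?_
    rw [LinearMap.smul_apply, arrowOp_tensorBasis]
    exact congrArg (a (arrowMk (coloring I) σ) • ·) (if_pos rfl)
  · intro f _ hf
    rw [LinearMap.sum_apply]
    refine Finset.sum_eq_zero fun σ _ => ?_
    rw [LinearMap.smul_apply, arrowOp_tensorBasis, if_neg (by exact hf), smul_zero]
  · simp

/-! ### Diagonal operators -/

/-- The block-diagonal operator on `V`. -/
def blockOp (M : Fin ℓ → Matrix (Fin m) (Fin m) ℂ) : Module.End ℂ (V ℓ m) :=
  Matrix.toLin' (Matrix.blockDiagonal M)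

theorem blockOp_apply (M : Fin ℓ → Matrix (Fin m) (Fin m) ℂ) (v : V ℓ m) (r : Fin m) (c : Fin ℓ) :
    blockOp M v (r, c) = ∑ r', M c r r' * v (r', c) := by
  classical
  simp only [blockOp, Matrix.toLin'_apply, Matrix.mulVec, dotProduct, Fintype.sum_prod_type,
    Matrix.blockDiagonal_apply]
  refine Finset.sum_congr rfl fun r' _ => ?_
  simp

theorem blockOp_blockProj (M : Fin ℓ → Matrix (Fin m) (Fin m) ℂ) (c : Fin ℓ) (v : V ℓ m) :
    blockOp M (blockProj m c v) = blockProj m c (blockOp M v) := by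
  funext ⟨r, c'⟩
  by_cases h : c' = c <;> simp [blockOp_apply, blockProj, h]

/-- The diagonal operator `B ⊗ ⋯ ⊗ B`. -/
def tensorOp (d : ℕ) (B : Module.End ℂ (V ℓ m)) : Module.End ℂ (TensorSpace ℓ m d) :=
  PiTensorProduct.map fun _ => B

theorem tensorOp_mul (B C : Module.End ℂ (V ℓ m)) :
    tensorOp d (B * C) = tensorOp d B * tensorOp d C :=
  PiTensorProduct.map_mul _ _

theorem tensorOp_tprod (B : Module.End ℂ (V ℓ m)) (w : Fin d → V ℓ m) :
    tensorOp d B (PiTensorProduct.tprod ℂ w) = PiTensorProduct.tprod ℂ fun j => B (w j) :=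
  PiTensorProduct.map_tprod _ _

theorem freeProdTensorRep_apply (x : FreeProd ℓ m) :
    freeProdTensorRep ℓ k m d x = tensorOp d (freeProdRep ℓ k m x) := rfl

theorem freeProdRep_inl (g : Fin ℓ → GL (Fin m) ℂ) :
    freeProdRep ℓ k m (Monoid.Coprod.inl g) =
      blockOp fun c => (g c : Matrix (Fin m) (Fin m) ℂ) := by
  rw [freeProdRep, Monoid.Coprod.lift_apply_inl]
  rfl

theorem blockShift_zpow_single (i : ℤ) (p : Fin m × Fin ℓ) :
    (blockShift ℓ k m ^ i : V ℓ m ≃ₗ[ℂ] V ℓ m) (Pi.single p 1) =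
      Pi.single (p.1, ((finRotate ℓ ^ (ℓ / k)) ^ i) p.2) 1 := by
  induction i generalizing p with
  | zero => rfl
  | succ i ih =>
    rw [zpow_add_one, zpow_add_one]
    change (blockShift ℓ k m ^ (i : ℤ) : V ℓ m ≃ₗ[ℂ] V ℓ m) (blockShift ℓ k m (Pi.single p 1)) = _
    rw [show p = (p.1, p.2) from rfl, blockShift_single, ih]
    rfl
  | pred i ih =>
    rw [zpow_sub_one, zpow_sub_one]
    change (blockShift ℓ k m ^ (-i : ℤ) : V ℓ m ≃ₗ[ℂ] V ℓ m)
      ((blockShift ℓ k m).symm (Pi.single p 1)) = _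
    have : (blockShift ℓ k m).symm (Pi.single p 1) =
        Pi.single (p.1, (finRotate ℓ ^ (ℓ / k))⁻¹ p.2) 1 := by
      rw [LinearEquiv.symm_apply_eq, blockShift_single]
      congr 1
      exact Prod.ext rfl ((finRotate ℓ ^ (ℓ / k)).apply_symm_apply p.2).symm
    rw [this, ih]
    rfl

theorem freeProdRep_inr_single (i : ℤ) (p : Fin m × Fin ℓ) :
    freeProdRep ℓ k m (Monoid.Coprod.inr (Multiplicative.ofAdd i)) (Pi.single p 1) =
      Pi.single (p.1, ((finRotate ℓ ^ (ℓ / k)) ^ i) p.2) 1 := by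
  rw [freeProdRep, Monoid.Coprod.lift_apply_inr, ← blockShift_zpow_single]
  rfl

/-- The operators `B ⊗ ⋯ ⊗ B` with `B` block-diagonal are combinations of those with `B`
invertible. -/
theorem tensorOp_blockOp_mem_span (M : Fin ℓ → Matrix (Fin m) (Fin m) ℂ) :
    tensorOp d (blockOp M) ∈ Submodule.span ℂ
      (Set.range fun g : Fin ℓ → GL (Fin m) ℂ =>
        freeProdTensorRep ℓ k m d (Monoid.Coprod.inl g)) := by
  have key := MultilinearMap.diag_mem_of_infinite
    (PiTensorProduct.mapMultilinear ℂ (fun _ : Fin d => V ℓ m) (fun _ : Fin d => V ℓ m))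
    (blockOp M) 1 (Submodule.span ℂ (Set.range fun g : Fin ℓ → GL (Fin m) ℂ =>
        freeProdTensorRep ℓ k m d (Monoid.Coprod.inl g)))
  refine key ?_
  -- Up to sign, `det (M c + t)` is the characteristic polynomial of `M c` at `-t`, so a
  -- perturbation by `t·1` is singular in some block only for finitely many `t`.
  have hfin : (⋃ c : Fin ℓ, {t : ℂ | ((M c).charpoly.comp (-Polynomial.X)).IsRoot t}).Finite := by
    refine Set.finite_iUnion fun c => Polynomial.finite_setOfPred_isRoot ?_
    intro h0
    -- Substituting `-X` a second time recovers the characteristic polynomial, which is monic.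
    have := congrArg (fun p => p.comp (-Polynomial.X)) h0
    simp [Polynomial.comp_assoc] at this
    exact (M c).charpoly_monic.ne_zero this
  refine hfin.infinite_compl.mono fun t ht => ?_
  have hdet : ∀ c, (M c + t • (1 : Matrix (Fin m) (Fin m) ℂ)).det ≠ 0 := by
    intro c h0
    refine ht (Set.mem_iUnion.2 ⟨c, ?_⟩)
    change Polynomial.eval t ((M c).charpoly.comp (-Polynomial.X)) = 0
    rw [Polynomial.eval_comp, Matrix.eval_charpoly]
    have : Matrix.scalar (Fin m) (Polynomial.eval t (-Polynomial.X)) - M c =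
        - (M c + t • (1 : Matrix (Fin m) (Fin m) ℂ)) := by
      rw [Matrix.scalar_apply, ← Matrix.smul_one_eq_diagonal, Polynomial.eval_neg,
        Polynomial.eval_X, neg_smul]
      abel
    rw [this, Matrix.det_neg, h0, mul_zero]
  refine Submodule.subset_span ⟨fun c => Matrix.GeneralLinearGroup.mkOfDetNeZero _ (hdet c), ?_⟩
  change freeProdTensorRep ℓ k m d _ = tensorOp d _
  rw [freeProdTensorRep_apply, freeProdRep_inl]
  congr 1
  refine LinearMap.ext fun v => ?_
  funext ⟨r, c⟩
  rw [blockOp_apply]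
  simp [blockOp_apply, Matrix.GeneralLinearGroup.mkOfDetNeZero, add_mul,
    Finset.sum_add_distrib, Matrix.one_apply]

end ColorGroupoid
end

noncomputable section
namespace ColorGroupoid

variable {ℓ k d m : ℕ}

/-! ### The two actions commute -/

/-- A block-diagonal operator commutes with the projections onto the blocks, and the same operator
in every tensor factor commutes with permuting the factors. -/
theorem commute_tensorOp_blockOp_arrowOp (M : Fin ℓ → Matrix (Fin m) (Fin m) ℂ)
    {f g : Coloring ℓ d} (σ : f ⟶ g) : Commute (tensorOp d (blockOp M)) (arrowOp m σ) := by
  refine PiTensorProduct.ext (MultilinearMap.ext fun w => ?_)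
  change tensorOp d (blockOp M) (arrowOp m σ (PiTensorProduct.tprod ℂ w)) =
    arrowOp m σ (tensorOp d (blockOp M) (PiTensorProduct.tprod ℂ w))
  rw [arrowOp_tprod, tensorOp_tprod, tensorOp_tprod, arrowOp_tprod]
  simp_rw [blockOp_blockProj]

theorem commute_tensorOp_blockOp_algebraAction (M : Fin ℓ → Matrix (Fin m) (Fin m) ℂ)
    (a : A ℓ d) : Commute (tensorOp d (blockOp M)) (algebraAction ℓ m d a) := by
  rw [algebraAction_apply]
  exact Commute.sum_right _ _ _ fun _ _ => Commute.sum_right _ _ _ fun _ _ =>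
    Commute.sum_right _ _ _ fun σ _ => (commute_tensorOp_blockOp_arrowOp M σ).smul_right _

/-- Rotation of the colours of a multi-index. -/
def rotateIndex (s : Equiv.Perm (Fin ℓ)) (I : Fin d → Fin m × Fin ℓ) : Fin d → Fin m × Fin ℓ :=
  fun j => ((I j).1, s (I j).2)

theorem rotateIndex_injective (s : Equiv.Perm (Fin ℓ)) :
    Function.Injective (rotateIndex s : (Fin d → Fin m × Fin ℓ) → _) := by
  intro I J h
  funext j
  have hj : ((I j).1, s (I j).2) = ((J j).1, s (J j).2) := congrFun h j
  exact Prod.ext (Prod.mk.inj hj).1 (s.injective (Prod.mk.inj hj).2)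

theorem coloring_rotateIndex (s : colorRotations ℓ k) (I : Fin d → Fin m × Fin ℓ) :
    coloring (rotateIndex s.1 I) = s • coloring I := rfl

theorem freeProdTensorRep_inr_tensorBasis (i : ℤ) (I : Fin d → Fin m × Fin ℓ) :
    freeProdTensorRep ℓ k m d (Monoid.Coprod.inr (Multiplicative.ofAdd i)) (tensorBasis ℓ m d I) =
      tensorBasis ℓ m d (rotateIndex ((finRotate ℓ ^ (ℓ / k)) ^ i) I) := by
  rw [freeProdTensorRep_apply, tensorBasis_apply, tensorOp_tprod, tensorBasis_apply]
  simp_rw [freeProdRep_inr_single]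
  rfl

theorem quotAction_apply (a : AQuot ℓ k d) :
    quotAction ℓ k m d a = algebraAction ℓ m d (quotEmbedding ℓ k d a) := rfl

/-- The block-diagonal factor commutes with all of `A_(ℓ,d)`. For the factor `ℤ` the commutation
amounts to rotation invariance of the coefficients, which holds on the image of `Ψ`. -/
theorem commute_freeProdTensorRep_quotAction (x : FreeProd ℓ m) (a : AQuot ℓ k d) :
    Commute (freeProdTensorRep ℓ k m d x) (quotAction ℓ k m d a) := by
  induction x using Monoid.Coprod.induction_on with
  | inl g =>
    rw [freeProdTensorRep_apply, freeProdRep_inl, quotAction_apply]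
    exact commute_tensorOp_blockOp_algebraAction _ _
  | inr i =>
    obtain ⟨i, rfl⟩ := Multiplicative.ofAdd.surjective i
    refine (tensorBasis ℓ m d).ext fun I => ?_
    rw [Module.End.mul_apply, Module.End.mul_apply, freeProdTensorRep_inr_tensorBasis,
      quotAction_apply, algebraAction_tensorBasis, algebraAction_tensorBasis, map_sum]
    refine Finset.sum_congr rfl fun σ _ => ?_
    rw [map_smul, freeProdTensorRep_inr_tensorBasis]
    have h := (mem_range_quotEmbedding_iff _).1 ⟨a, rfl⟩
      ⟨(finRotate ℓ ^ (ℓ / k)) ^ i, ⟨i, rfl⟩⟩ (arrowMk (coloring I) σ)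
    rw [smul_arrowMk, ← coloring_rotateIndex] at h
    exact congrArg₂ (· • ·) h.symm rfl
  | mul x y hx hy =>
    rw [map_mul]
    exact hx.mul_left hy

/-! ### Operators commuting with the free product -/

theorem blockOp_diagonal_single (w : Fin m × Fin ℓ → ℂ) (p : Fin m × Fin ℓ) :
    blockOp (fun c => Matrix.diagonal fun r => w (r, c)) (Pi.single p 1) =
      w p • Pi.single p 1 := by
  funext ⟨r, c⟩
  rw [blockOp_apply]
  by_cases h : (r, c) = p
  · subst h
    simp [Matrix.diagonal_apply]
  · simp [Matrix.diagonal_apply, h]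

theorem tensorOp_diagonal_tensorBasis (w : Fin m × Fin ℓ → ℂ) (J : Fin d → Fin m × Fin ℓ) :
    tensorOp d (blockOp (fun c => Matrix.diagonal fun r => w (r, c))) (tensorBasis ℓ m d J) =
      (∏ j, w (J j)) • tensorBasis ℓ m d J := by
  rw [tensorBasis_apply, tensorOp_tprod, ← MultilinearMap.map_smul_univ]
  simp_rw [blockOp_diagonal_single]

/-- The matrix coefficients of an operator on the tensor space. -/
def coeff (T : Module.End ℂ (TensorSpace ℓ m d)) (I J : Fin d → Fin m × Fin ℓ) : ℂ :=
  (tensorBasis ℓ m d).repr (T (tensorBasis ℓ m d I)) J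

theorem apply_tensorBasis_eq_sum (T : Module.End ℂ (TensorSpace ℓ m d))
    (I : Fin d → Fin m × Fin ℓ) :
    T (tensorBasis ℓ m d I) = ∑ J, coeff T I J • tensorBasis ℓ m d J :=
  ((tensorBasis ℓ m d).sum_repr _).symm

/-- Compare the coordinates at `u J` of `T U e_I` and `U T e_I`; injectivity of `u` leaves only the
term of `J`. It serves for diagonal matrices, shifts, place permutations and orbit projections. -/
theorem coeff_eq_of_commute_monomial {T U : Module.End ℂ (TensorSpace ℓ m d)} (h : Commute T U)
    (u : (Fin d → Fin m × Fin ℓ) → (Fin d → Fin m × Fin ℓ)) (hu : Function.Injective u)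
    (c : (Fin d → Fin m × Fin ℓ) → ℂ)
    (hU : ∀ I, U (tensorBasis ℓ m d I) = c I • tensorBasis ℓ m d (u I))
    (I J : Fin d → Fin m × Fin ℓ) :
    c I * coeff T (u I) (u J) = c J * coeff T I J := by
  classical
  have h₁ := congrArg (fun v => (tensorBasis ℓ m d).repr v (u J))
    (LinearMap.congr_fun h.eq (tensorBasis ℓ m d I))
  simp only [Module.End.mul_apply] at h₁
  rw [hU, map_smul, map_smul, apply_tensorBasis_eq_sum T I, map_sum, map_sum,
    Finsupp.finsetSum_apply, Finset.sum_eq_single J] at h₁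
  · simp only [map_smul, hU, Finsupp.smul_apply, smul_eq_mul, Module.Basis.repr_self,
      Finsupp.single_eq_same, mul_one] at h₁
    rw [coeff, h₁, mul_comm]
  · intro K _ hK
    simp [hU, hu.ne hK]
  · simp

theorem coeff_tensorBasis_injective_index {T : Module.End ℂ (TensorSpace ℓ m d)}
    (hT : ∀ M : Fin ℓ → Matrix (Fin m) (Fin m) ℂ, Commute T (tensorOp d (blockOp M)))
    {I J : Fin d → Fin m × Fin ℓ} (hI : Function.Injective I) (hJ : coeff T I J ≠ 0) :
    ∃ σ : Equiv.Perm (Fin d), I ∘ σ.symm = J := by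
  classical
  have hmem : ∀ j₀, ∃ j, J j = I j₀ := by
    intro j₀
    by_contra! hne
    -- The diagonal matrix that kills the basis vector `I j₀` and fixes the others: if `J` misses `I
    -- j₀`, it has eigenvalue `0` on `e_I` and `1` on `e_J`, so the coefficient vanishes.
    let w : Fin m × Fin ℓ → ℂ := fun p => if p = I j₀ then 0 else 1
    have h := coeff_eq_of_commute_monomial
      (hT fun c => Matrix.diagonal fun r => w (r, c)) id Function.injective_id _
      (tensorOp_diagonal_tensorBasis w) I J
    rw [Finset.prod_eq_zero (Finset.mem_univ j₀) (by simp [w]), zero_mul,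
      Finset.prod_eq_one (fun j _ => by simp [w, hne j]), one_mul] at h
    exact hJ h.symm
  choose τ hτ using hmem
  have hτi : Function.Injective τ := fun a b hab => hI (by rw [← hτ a, ← hτ b, hab])
  refine ⟨Equiv.ofBijective τ (Finite.injective_iff_bijective.1 hτi), ?_⟩
  funext j
  obtain ⟨i, rfl⟩ := (Equiv.ofBijective τ (Finite.injective_iff_bijective.1 hτi)).surjective j
  rw [Function.comp_apply, Equiv.symm_apply_apply]
  exact (hτ i).symm

/-- A multi-index of colouring `f` with pairwise distinct entries. -/
def baseIndex (h : d ≤ m) (f : Coloring ℓ d) : Fin d → Fin m × Fin ℓ :=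
  fun j => (Fin.castLE h j, f.color j)

theorem baseIndex_injective (h : d ≤ m) (f : Coloring ℓ d) :
    Function.Injective (baseIndex h f) := fun _ _ e =>
  Fin.castLE_injective h (congrArg Prod.fst e)

/-- Every basis vector is the image of the vector given by the base index of its colouring. -/
theorem exists_tensorOp_blockOp_baseIndex (h : d ≤ m) (I : Fin d → Fin m × Fin ℓ) :
    ∃ M : Fin ℓ → Matrix (Fin m) (Fin m) ℂ,
      tensorOp d (blockOp M) (tensorBasis ℓ m d (baseIndex h (coloring I))) =
        tensorBasis ℓ m d I := by
  classical
  -- The same matrix in every block: column `j < d` sends position `j` to the position of `I j`, and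
  -- the remaining columns are zero. It may be singular.
  refine ⟨fun _ => Matrix.of fun r r' =>
    if hr : (r' : ℕ) < d then (if (I ⟨r', hr⟩).1 = r then 1 else 0) else 0, ?_⟩
  rw [tensorBasis_apply, tensorOp_tprod, tensorBasis_apply]
  congr 1
  funext j ⟨r, c⟩
  rw [blockOp_apply, Finset.sum_eq_single (Fin.castLE h j)]
  · by_cases h₁ : (I j).1 = r <;> by_cases h₂ : (I j).2 = c <;>
      simp [baseIndex, coloring, Pi.single_apply, Prod.ext_iff, h₁, h₂]
  · intro r' _ hr'
    simp [baseIndex, hr']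
  · simp

/-- The operator is recovered from its values at the base indices, since block-diagonal operators
produce every basis vector from these. -/
theorem mem_range_quotAction_of_commute (h : d ≤ m) (T : Module.End ℂ (TensorSpace ℓ m d))
    (hT : ∀ x, Commute T (freeProdTensorRep ℓ k m d x)) : T ∈ (quotAction ℓ k m d).range := by
  have hM : ∀ M : Fin ℓ → Matrix (Fin m) (Fin m) ℂ, Commute T (tensorOp d (blockOp M)) := by
    intro M
    -- The centralizer of `T` is a subspace, so it contains the span of the invertible
    -- block-diagonal operators.
    have hle : Submodule.span ℂ (Set.range fun g : Fin ℓ → GL (Fin m) ℂ =>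
        freeProdTensorRep ℓ k m d (Monoid.Coprod.inl g)) ≤
        Subalgebra.toSubmodule (Subalgebra.centralizer ℂ {T}) := by
      rw [Submodule.span_le]
      rintro _ ⟨g, rfl⟩
      rw [SetLike.mem_coe, Subalgebra.mem_toSubmodule, Subalgebra.mem_centralizer_iff]
      rintro _ rfl
      exact hT (Monoid.Coprod.inl g)
    have := hle (tensorOp_blockOp_mem_span (k := k) M)
    rw [Subalgebra.mem_toSubmodule, Subalgebra.mem_centralizer_iff] at this
    exact this T rfl
  let b : A ℓ d := fun x =>
    coeff T (baseIndex h x.1) (baseIndex h x.1 ∘ (perm x.2.2).symm)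
  have hb : ∀ (s : colorRotations ℓ k) (x : Arrows (Coloring ℓ d)), b (s • x) = b x := by
    rintro ⟨_, i, rfl⟩ x
    -- A rotation sends the base index of a colouring to the base index of the rotated colouring, as
    -- the positions do not depend on the colours.
    have := coeff_eq_of_commute_monomial (hT (Monoid.Coprod.inr (Multiplicative.ofAdd i)))
      (rotateIndex ((finRotate ℓ ^ (ℓ / k)) ^ i)) (rotateIndex_injective _) (fun _ => 1)
      (fun I => by rw [freeProdTensorRep_inr_tensorBasis, one_smul])
      (baseIndex h x.1) (baseIndex h x.1 ∘ (perm x.2.2).symm)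
    rw [one_mul, one_mul] at this
    exact this
  obtain ⟨a, ha⟩ := (mem_range_quotEmbedding_iff b).2 hb
  refine ⟨a, ?_⟩
  change quotAction ℓ k m d a = T
  rw [quotAction_apply, ha]
  have hbase : ∀ f : Coloring ℓ d, algebraAction ℓ m d b (tensorBasis ℓ m d (baseIndex h f)) =
      T (tensorBasis ℓ m d (baseIndex h f)) := by
    intro f
    rw [algebraAction_tensorBasis, apply_tensorBasis_eq_sum T]
    -- The entries of the base index are distinct, so different permutations give different basis
    -- vectors; at all other multi-indices the coefficient of `T` is zero.
    refine Fintype.sum_of_injective (fun σ : Equiv.Perm (Fin d) => baseIndex h f ∘ σ.symm) ?_ _ _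
      ?_ (fun σ => rfl)
    · intro σ τ hστ
      refine Equiv.symm_bijective.injective (Equiv.ext fun j => ?_)
      exact baseIndex_injective h f (congrFun hστ j)
    · intro J hJ
      by_contra hne
      refine hJ (coeff_tensorBasis_injective_index hM (baseIndex_injective h f) ?_)
      exact fun h0 => hne (by rw [h0, zero_smul])
  refine (tensorBasis ℓ m d).ext fun I => ?_
  obtain ⟨M, hMI⟩ := exists_tensorOp_blockOp_baseIndex h I
  rw [← hMI, ← Module.End.mul_apply, ← Module.End.mul_apply, (hM M).eq,
    ← (commute_tensorOp_blockOp_algebraAction M b).eq, Module.End.mul_apply, Module.End.mul_apply,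
    hbase]

/-! ### Operators commuting with the groupoid algebra -/

/-- The matrix unit sending the basis vector `q` to the basis vector `p`. -/
def matrixUnit (p q : Fin m × Fin ℓ) : Module.End ℂ (V ℓ m) :=
  (LinearMap.proj q : V ℓ m →ₗ[ℂ] ℂ).smulRight (Pi.single p 1)

theorem matrixUnit_single (p q r : Fin m × Fin ℓ) :
    matrixUnit p q (Pi.single r 1) = if r = q then Pi.single p 1 else 0 := by
  by_cases h : r = q
  · subst h; simp [matrixUnit]
  · simp [matrixUnit, h, Ne.symm h]

open Classical in
theorem map_matrixUnit_tensorBasis (J I K : Fin d → Fin m × Fin ℓ) :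
    PiTensorProduct.map (fun j => matrixUnit (J j) (I j)) (tensorBasis ℓ m d K) =
      if K = I then tensorBasis ℓ m d J else 0 := by
  rw [tensorBasis_apply, PiTensorProduct.map_tprod]
  simp_rw [matrixUnit_single]
  split_ifs with h
  · subst h
    simp [tensorBasis_apply]
  · obtain ⟨j, hj⟩ := Function.ne_iff.1 h
    exact (PiTensorProduct.tprod ℂ).map_coord_zero j (if_neg hj)

theorem eq_sum_coeff_smul_map_matrixUnit (T : Module.End ℂ (TensorSpace ℓ m d)) :
    T = ∑ I, ∑ J, coeff T I J • PiTensorProduct.map (fun j => matrixUnit (J j) (I j)) := by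
  classical
  refine (tensorBasis ℓ m d).ext fun K => ?_
  rw [LinearMap.sum_apply, Finset.sum_eq_single K]
  · rw [apply_tensorBasis_eq_sum T, LinearMap.sum_apply]
    refine Finset.sum_congr rfl fun J _ => ?_
    rw [LinearMap.smul_apply, map_matrixUnit_tensorBasis, if_pos rfl]
  · intro I _ hI
    rw [LinearMap.sum_apply]
    refine Finset.sum_eq_zero fun J _ => ?_
    rw [LinearMap.smul_apply, map_matrixUnit_tensorBasis, if_neg hI.symm, smul_zero]
  · simp

theorem blockOp_sum {ι : Type*} (s : Finset ι) (M : ι → Fin ℓ → Matrix (Fin m) (Fin m) ℂ) :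
    ∑ j ∈ s, blockOp (M j) = blockOp (∑ j ∈ s, M j) := by
  refine LinearMap.ext fun v => ?_
  funext ⟨r, c⟩
  rw [LinearMap.sum_apply, Finset.sum_apply]
  simp only [blockOp_apply, Finset.sum_apply, Matrix.sum_apply, Finset.sum_mul]
  rw [Finset.sum_comm]

/-- A matrix unit whose colours differ by a rotation is a rotation of a block-diagonal matrix. -/
theorem matrixUnit_eq_rotation_mul_blockOp (i : ℤ) (p q : Fin m × Fin ℓ)
    (h : p.2 = ((finRotate ℓ ^ (ℓ / k)) ^ i) q.2) :
    matrixUnit p q = freeProdRep ℓ k m (Monoid.Coprod.inr (Multiplicative.ofAdd i)) *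
      blockOp (Pi.single q.2 (Matrix.single p.1 q.1 1)) := by
  classical
  refine (Pi.basisFun ℂ (Fin m × Fin ℓ)).ext fun r => ?_
  rw [Pi.basisFun_apply, Module.End.mul_apply, matrixUnit_single]
  have : blockOp (Pi.single q.2 (Matrix.single p.1 q.1 1)) (Pi.single r 1 : V ℓ m) =
      if r = q then Pi.single (p.1, q.2) 1 else 0 := by
    funext ⟨a, c⟩
    rw [blockOp_apply]
    obtain ⟨q₁, q₂⟩ := q
    obtain ⟨r₁, r₂⟩ := r
    by_cases hc : c = q₂
    · subst hc
      by_cases hr : r₂ = c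
      · subst hr
        by_cases hq : r₁ = q₁
        · subst hq
          rcases eq_or_ne p.1 a with ha | ha
          · simp [← ha, Matrix.single_apply, Pi.single_apply]
          · simp [Pi.single_apply, ha, ha.symm]
        · simp [Matrix.single_apply, Pi.single_apply, hq, Ne.symm hq]
      · simp [hr, Ne.symm hr]
    · split_ifs <;> simp [Pi.single_apply, hc]
  rw [this]
  split_ifs
  · rw [freeProdRep_inr_single, ← h]
  · rw [map_zero]

/-- Polarization leaves only diagonal operators of partial sums. Because the exponent `i` is common
to all places, the rotation factors out of each sum and a block-diagonal operator remains. -/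
theorem sum_perm_matrixUnit_mem_span (i : ℤ) (I J : Fin d → Fin m × Fin ℓ)
    (h : ∀ j, (J j).2 = ((finRotate ℓ ^ (ℓ / k)) ^ i) (I j).2) :
    ∑ σ : Equiv.Perm (Fin d), PiTensorProduct.map (fun j => matrixUnit (J (σ j)) (I (σ j))) ∈
      Submodule.span ℂ (Set.range (freeProdTensorRep ℓ k m d)) := by
  refine MultilinearMap.sum_perm_mem (K := ℂ) (E := V ℓ m →ₗ[ℂ] V ℓ m)
    (F := TensorSpace ℓ m d →ₗ[ℂ] TensorSpace ℓ m d)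
    (PiTensorProduct.mapMultilinear ℂ (fun _ : Fin d => V ℓ m) (fun _ : Fin d => V ℓ m))
    (fun j => matrixUnit (J j) (I j)) _ fun s => ?_
  change tensorOp d (∑ j ∈ s, matrixUnit (J j) (I j)) ∈ _
  rw [Finset.sum_congr rfl fun j _ => matrixUnit_eq_rotation_mul_blockOp i _ _ (h j),
    ← Finset.mul_sum, blockOp_sum, tensorOp_mul]
  rw [← freeProdTensorRep_apply]
  have := tensorOp_blockOp_mem_span (k := k) (d := d)
    (∑ j ∈ s, Pi.single (I j).2 (Matrix.single (J j).1 (I j).1 1))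
  refine Submodule.span_induction ?_ ?_ ?_ ?_ this
  · rintro _ ⟨g, rfl⟩
    refine Submodule.subset_span ⟨_, map_mul _ _ _⟩
  · rw [mul_zero]
    exact zero_mem _
  · intro x y _ _ hx hy
    rw [mul_add]
    exact add_mem hx hy
  · intro c x _ hx
    rw [mul_smul_comm]
    exact Submodule.smul_mem _ c hx

/-- The sum of all arrows with underlying permutation `σ⁻¹` is rotation-invariant and acts by `e_I ↦
e_{I ∘ σ}`. -/
theorem coeff_comp_perm {T : Module.End ℂ (TensorSpace ℓ m d)}
    (hT : ∀ a, Commute T (quotAction ℓ k m d a)) (σ : Equiv.Perm (Fin d))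
    (I J : Fin d → Fin m × Fin ℓ) : coeff T (I ∘ σ) (J ∘ σ) = coeff T I J := by
  classical
  let b : A ℓ d := fun x => if perm x.2.2 = σ.symm then 1 else 0
  obtain ⟨a, ha⟩ := (mem_range_quotEmbedding_iff (k := k) b).2 fun _ _ => rfl
  have := coeff_eq_of_commute_monomial (hT a) (fun I => I ∘ σ)
    (fun _ _ h => σ.surjective.injective_comp_right h) (fun _ => 1) ?_ I J
  · simpa using this
  · intro K
    rw [quotAction_apply, ha, algebraAction_tensorBasis, Finset.sum_eq_single σ.symm]
    · exact congrArg₂ (· • ·) (if_pos rfl) rfl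
    · intro τ _ hτ
      exact (congrArg₂ (· • ·) (if_neg hτ) rfl).trans (zero_smul ℂ _)
    · simp

/-- The sum of the identities of all colourings in one orbit is rotation-invariant and acts as the
projection onto the corresponding summands. -/
theorem orb_eq_of_coeff_ne_zero {T : Module.End ℂ (TensorSpace ℓ m d)}
    (hT : ∀ a, Commute T (quotAction ℓ k m d a)) {I J : Fin d → Fin m × Fin ℓ}
    (h : coeff T I J ≠ 0) : orb k (coloring J) = orb k (coloring I) := by
  classical
  let b : A ℓ d := fun x =>
    if perm x.2.2 = 1 then (if orb k x.1 = orb k (coloring I) then 1 else 0) else 0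
  obtain ⟨a, ha⟩ := (mem_range_quotEmbedding_iff (k := k) b).2 fun s x => by
    change (if perm x.2.2 = 1 then (if orb k (s • x.1) = _ then (1 : ℂ) else 0) else 0) =
      if perm x.2.2 = 1 then (if orb k x.1 = _ then 1 else 0) else 0
    rw [orb_smul]
  have := coeff_eq_of_commute_monomial (hT a) id Function.injective_id
    (fun K => if orb k (coloring K) = orb k (coloring I) then 1 else 0) ?_ I J
  · by_contra hne
    rw [if_pos rfl, if_neg hne, one_mul, zero_mul] at this
    exact h this
  · intro K
    rw [quotAction_apply, ha, algebraAction_tensorBasis, Finset.sum_eq_single 1]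
    · exact congrArg₂ (· • ·) (if_pos rfl) rfl
    · intro τ _ hτ
      exact (congrArg₂ (· • ·) (if_neg hτ) rfl).trans (zero_smul ℂ _)
    · simp

theorem mem_span_of_commute_quotAction (T : Module.End ℂ (TensorSpace ℓ m d))
    (hT : ∀ a, Commute T (quotAction ℓ k m d a)) :
    T ∈ Submodule.span ℂ (Set.range (freeProdTensorRep ℓ k m d)) := by
  classical
  have hreindex : ∀ σ : Equiv.Perm (Fin d), T = ∑ I, ∑ J,
      coeff T I J • PiTensorProduct.map (fun j => matrixUnit (J (σ j)) (I (σ j))) := by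
    intro σ
    conv_lhs => rw [eq_sum_coeff_smul_map_matrixUnit T]
    let e : (Fin d → Fin m × Fin ℓ) ≃ (Fin d → Fin m × Fin ℓ) := Equiv.arrowCongr σ.symm (.refl _)
    refine (Fintype.sum_equiv e _ _ fun I => Fintype.sum_equiv e _ _ fun J => ?_).symm
    rw [← coeff_comp_perm hT σ I J]
    rfl
  -- Summing the reindexed expansions over `S_d` gives `d! • T`; the factor is invertible in `ℂ`.
  have hsum : (Fintype.card (Equiv.Perm (Fin d)) : ℂ) • T = ∑ I, ∑ J, coeff T I J •
      ∑ σ : Equiv.Perm (Fin d),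
        PiTensorProduct.map (fun j => matrixUnit (J (σ j)) (I (σ j))) := by
    simp_rw [Finset.smul_sum]
    rw [Finset.sum_congr rfl fun I _ => Finset.sum_comm, Finset.sum_comm,
      ← Finset.sum_congr rfl fun σ _ => hreindex σ, Finset.sum_const, Finset.card_univ,
      Nat.cast_smul_eq_nsmul]
  have hmem : (Fintype.card (Equiv.Perm (Fin d)) : ℂ) • T ∈
      Submodule.span ℂ (Set.range (freeProdTensorRep ℓ k m d)) := by
    rw [hsum]
    refine Submodule.sum_mem _ fun I _ => Submodule.sum_mem _ fun J _ => ?_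
    by_cases h0 : coeff T I J = 0
    · rw [h0, zero_smul]
      exact zero_mem _
    -- A nonzero coefficient yields a single power of the generator that moves the colours of `I` to
    -- those of `J` at all places at once.
    · obtain ⟨⟨_, i, rfl⟩, hs⟩ := orb_eq_iff.1 (orb_eq_of_coeff_ne_zero hT h0)
      exact Submodule.smul_mem _ _ (sum_perm_matrixUnit_mem_span i I J fun j =>
        (congrFun (congrArg Coloring.color hs) j).symm)
  have hne : (Fintype.card (Equiv.Perm (Fin d)) : ℂ) ≠ 0 :=
    Nat.cast_ne_zero.2 Fintype.card_ne_zero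
  simpa [smul_smul, inv_mul_cancel₀ hne] using
    Submodule.smul_mem _ (Fintype.card (Equiv.Perm (Fin d)) : ℂ)⁻¹ hmem

theorem centralizer_range_freeProdTensorRep (h : d ≤ m) :
    Subalgebra.centralizer ℂ (Set.range (freeProdTensorRep ℓ k m d)) =
      (quotAction ℓ k m d).range := by
  ext T
  constructor
  · intro hT
    exact mem_range_quotAction_of_commute h T fun x =>
      ((Subalgebra.mem_centralizer_iff ℂ).1 hT _ ⟨x, rfl⟩).symm
  · rintro ⟨a, rfl⟩
    rw [Subalgebra.mem_centralizer_iff]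
    rintro _ ⟨x, rfl⟩
    exact commute_freeProdTensorRep_quotAction x a

theorem centralizer_range_quotAction :
    Subalgebra.centralizer ℂ (Set.range (quotAction ℓ k m d)) =
      (freeProdTensorRep ℓ k m d).asAlgebraHom.range := by
  ext T
  constructor
  · intro hT
    have h := mem_span_of_commute_quotAction T fun a =>
      ((Subalgebra.mem_centralizer_iff ℂ).1 hT _ ⟨a, rfl⟩).symm
    have hle : Submodule.span ℂ (Set.range (freeProdTensorRep ℓ k m d)) ≤
        Subalgebra.toSubmodule (freeProdTensorRep ℓ k m d).asAlgebraHom.range := by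
      rw [Submodule.span_le]
      rintro _ ⟨x, rfl⟩
      exact ⟨MonoidAlgebra.of ℂ _ x, Representation.asAlgebraHom_of _ x⟩
    exact hle h
  · rintro ⟨y, rfl⟩
    rw [Subalgebra.mem_centralizer_iff]
    rintro _ ⟨a, rfl⟩
    change _ * (freeProdTensorRep ℓ k m d).asAlgebraHom y =
      (freeProdTensorRep ℓ k m d).asAlgebraHom y * _
    induction y using MonoidAlgebra.induction_on with
    | of x =>
      rw [Representation.asAlgebraHom_of]
      exact (commute_freeProdTensorRep_quotAction x a).eq.symm
    | add x y hx hy => rw [map_add, mul_add, add_mul, hx, hy]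
    | smul c x hx => rw [map_smul, mul_smul_comm, smul_mul_assoc, hx]

end ColorGroupoid
end

noncomputable section
namespace ColorGroupoid

variable {ℓ k d m : ℕ}

/-! ### The group algebra of the reflection group -/

theorem monomialMatrix_inj {σ τ : Equiv.Perm (Fin d)} {z w : Fin d → ℂ} (hz : ∀ j, z j ≠ 0)
    (h : monomialMatrix σ z = monomialMatrix τ w) : σ = τ ∧ z = w := by
  have key : ∀ j, σ j = τ j ∧ z j = w j := by
    intro j
    have hj := congrFun (congrFun h (σ j)) j
    simp only [monomialMatrix, Matrix.of_apply, if_true] at hj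
    by_cases hσ : σ j = τ j
    · rw [if_pos hσ] at hj
      exact ⟨hσ, hj⟩
    · rw [if_neg hσ] at hj
      exact absurd hj (hz j)
  exact ⟨Equiv.ext fun j => (key j).1, funext fun j => (key j).2⟩

theorem monomialElement_arrowMk (f : Coloring ℓ d) (σ τ : Equiv.Perm (Fin d)) (z : Fin d → ℂ)
    [Decidable (σ = τ)] : monomialElement ℓ τ z (arrowMk f σ) =
      if σ = τ then ∏ j, z j ^ ((f.color j : ℕ) + 1) else 0 := by
  split_ifs with h
  · exact if_pos h
  · exact if_neg h

/-- The only factorisation of an arrow from `f` that contributes passes through `f ∘ τ⁻¹`. The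
colour of `τ j` there is `f j`, so after reindexing by `τ` the exponents of `z (τ j)` and `w j`
agree. -/
theorem monomialElement_mul (σ τ : Equiv.Perm (Fin d)) (z w : Fin d → ℂ) :
    monomialElement ℓ σ z * monomialElement ℓ τ w =
      monomialElement ℓ (σ * τ) (fun j => z (τ j) * w j) := by
  classical
  ext x
  obtain ⟨⟨f, ρ⟩, rfl⟩ := (arrowEquiv ℓ d).surjective x
  change (monomialElement ℓ σ z * monomialElement ℓ τ w) (arrowMk f ρ) = _
  rw [show (arrowEquiv ℓ d) (f, ρ) = arrowMk f ρ from rfl, monomialElement_arrowMk]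
  change ∑ g : Coloring ℓ d, ∑ α : (f ⟶ g),
    (if ρ * (perm α)⁻¹ = σ then ∏ j, z j ^ ((g.color j : ℕ) + 1) else 0) *
      (if perm α = τ then ∏ j, w j ^ ((f.color j : ℕ) + 1) else 0) = _
  let g₀ : Coloring ℓ d := ⟨f.color ∘ τ.symm⟩
  let α₀ : f ⟶ g₀ := (arrowMk f τ).2.2
  rw [Finset.sum_eq_single g₀, Finset.sum_eq_single α₀]
  · rw [if_pos (show perm α₀ = τ from rfl), show perm α₀ = τ from rfl]
    by_cases hρ : ρ = σ * τ
    · rw [if_pos hρ, if_pos (by rw [hρ, mul_inv_cancel_right]),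
        ← Equiv.prod_comp τ (fun j => z j ^ ((g₀.color j : ℕ) + 1)), ← Finset.prod_mul_distrib]
      refine Finset.prod_congr rfl fun j _ => ?_
      have : g₀.color (τ j) = f.color j := congrArg f.color (τ.symm_apply_apply j)
      rw [this, mul_pow]
    · rw [if_neg hρ, if_neg (fun h => hρ (by rw [← h, inv_mul_cancel_right])), zero_mul]
  · intro α _ hα
    rw [if_neg (show ¬ perm α = τ from fun h => hα (perm_injective h)), mul_zero]
  · simp
  · intro g _ hg
    refine Finset.sum_eq_zero fun α _ => ?_
    suffices h : ¬ perm α = τ by rw [if_neg h, mul_zero]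
    rintro rfl
    refine hg (Coloring.ext ?_)
    have := color_comp_perm α
    funext i
    change g.color i = f.color ((perm α).symm i)
    rw [← this]
    simp
  · simp

theorem monomialElement_one : monomialElement ℓ (1 : Equiv.Perm (Fin d)) 1 = 1 := by
  classical
  ext x
  change (if perm x.2.2 = 1 then ∏ j, (1 : ℂ) ^ ((x.1.color j : ℕ) + 1) else 0) =
    if x = ⟨x.1, x.1, 𝟙 x.1⟩ then 1 else 0
  have : perm x.2.2 = 1 ↔ x = ⟨x.1, x.1, 𝟙 x.1⟩ := by
    constructor
    · intro h
      exact arrow_ext rfl h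
    · intro h
      rw [h]
      rfl
  simp only [this, one_pow, Finset.prod_const_one]

/-- Colour `c` carries the exponent `c + 1`, so the last colour has exponent `ℓ` and `z ^ ℓ = 1`
absorbs the wrap-around. -/
theorem pow_finRotate {z : ℂ} (hz : z ^ ℓ = 1) (c : Fin ℓ) :
    z ^ ((finRotate ℓ c : ℕ) + 1) = z ^ ((c : ℕ) + 1) * z := by
  cases ℓ with
  | zero => exact c.elim0
  | succ n =>
    rw [finRotate_apply, Fin.val_add_one]
    split_ifs with h
    · rw [h, Fin.val_last, hz, zero_add, pow_one, one_mul]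
    · rw [pow_succ]

theorem pow_finRotate_pow {z : ℂ} (hz : z ^ ℓ = 1) (n : ℕ) (c : Fin ℓ) :
    z ^ (((finRotate ℓ ^ n) c : ℕ) + 1) = z ^ ((c : ℕ) + 1) * z ^ n := by
  induction n with
  | zero => simp
  | succ n ih =>
    rw [pow_succ' (finRotate ℓ), Equiv.Perm.mul_apply, pow_finRotate hz, ih, pow_succ z n, mul_assoc]

/-- The generator of the group of colour rotations. -/
def rotationGenerator (ℓ k : ℕ) : colorRotations ℓ k :=
  ⟨finRotate ℓ ^ (ℓ / k), Subgroup.mem_zpowers _⟩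

/-- Rotating every colour by `ℓ / k` multiplies the `j`-th factor by `z j ^ (ℓ / k)`. Invariance is
thus the determinant-type condition defining `G(ℓ,k,d)`. -/
theorem monomialElement_smul {σ : Equiv.Perm (Fin d)} {z : Fin d → ℂ} (hz : ∀ j, z j ^ ℓ = 1)
    (x : Arrows (Coloring ℓ d)) :
    monomialElement ℓ σ z (rotationGenerator ℓ k • x) =
      (∏ j, z j) ^ (ℓ / k) * monomialElement ℓ σ z x := by
  classical
  change (if perm x.2.2 = σ then
      ∏ j, z j ^ (((finRotate ℓ ^ (ℓ / k)) (x.1.color j) : ℕ) + 1) else 0) =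
    _ * (if perm x.2.2 = σ then ∏ j, z j ^ ((x.1.color j : ℕ) + 1) else 0)
  split_ifs
  · rw [← Finset.prod_pow, ← Finset.prod_mul_distrib]
    refine Finset.prod_congr rfl fun j _ => ?_
    rw [pow_finRotate_pow (hz j), mul_comm]
  · rw [mul_zero]

/-! ### A basis of `A_(ℓ,d)` from independence of characters. -/

/-- The character `n ↦ ∏ j, z j ^ n j` of `ℕ^d`. -/
def powChar (z : Fin d → ℂ) : (Fin d → Multiplicative ℕ) →* ℂ where
  toFun n := ∏ j, z j ^ (n j).toAdd
  map_one' := by simp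
  map_mul' n n' := by simp [pow_add, Finset.prod_mul_distrib]

/-- The tuple is recovered by evaluation at the unit vectors; Dedekind's theorem needs the
characters to be distinct. -/
theorem powChar_injective : Function.Injective (powChar : (Fin d → ℂ) → _) := by
  intro z w h
  funext j
  have hs : ∀ v : Fin d → ℂ, powChar v (Pi.mulSingle j (Multiplicative.ofAdd 1)) = v j := by
    intro v
    change ∏ i, v i ^ ((Pi.mulSingle j (Multiplicative.ofAdd 1) :
      Fin d → Multiplicative ℕ) i).toAdd = v j
    rw [Finset.prod_eq_single j]
    · simp
    · intro i _ hi
      simp [Pi.mulSingle_eq_of_ne hi]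
    · simp
  rw [← hs z, h, hs]

/-- The elements attached to all monomial matrices whose nonzero entries are `ℓ`-th roots of
unity. -/
def monomialFamily (ℓ d : ℕ) (p : Equiv.Perm (Fin d) × (Fin d → rootsOfUnity ℓ ℂ)) : A ℓ d :=
  monomialElement ℓ p.1 fun j => ((p.2 j : ℂˣ) : ℂ)

theorem coe_rootsOfUnity_pow (ζ : rootsOfUnity ℓ ℂ) : ((ζ : ℂˣ) : ℂ) ^ ℓ = 1 := by
  have := (mem_rootsOfUnity ℓ (ζ : ℂˣ)).1 ζ.2
  rw [← Units.val_pow_eq_pow_val, this, Units.val_one]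

theorem linearIndependent_monomialFamily [NeZero ℓ] :
    LinearIndependent ℂ (monomialFamily ℓ d) := by
  classical
  have : Fintype (rootsOfUnity ℓ ℂ) := Fintype.ofFinite _
  rw [Fintype.linearIndependent_iff]
  rintro c hc ⟨σ, ζ₀⟩
  have hchar : LinearIndependent ℂ (fun ζ : Fin d → rootsOfUnity ℓ ℂ =>
      (powChar (fun j => ((ζ j : ℂˣ) : ℂ)) : (Fin d → Multiplicative ℕ) → ℂ)) := by
    refine (linearIndependent_monoidHom (Fin d → Multiplicative ℕ) ℂ).comp
      (fun ζ : Fin d → rootsOfUnity ℓ ℂ => powChar (fun j => ((ζ j : ℂˣ) : ℂ))) ?_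
    intro ζ ζ' h
    have h' := powChar_injective h
    funext j
    exact Subtype.ext (Units.ext (congrFun h' j))
  -- For fixed `σ`, the coefficients on arrows with permutation `σ` are values of these characters,
  -- so the relation becomes one between characters.
  refine Fintype.linearIndependent_iff.1 hchar (fun ζ => c (σ, ζ)) ?_ ζ₀
  funext n
  have hpos : 0 < ℓ := NeZero.pos ℓ
  -- The colouring must realise the exponents `n j` modulo `ℓ`. As colour `c` has exponent `c + 1`,
  -- one is subtracted, in the form of adding `ℓ - 1`.
  let f : Coloring ℓ d := ⟨fun j => ⟨((n j).toAdd + (ℓ - 1)) % ℓ, Nat.mod_lt _ hpos⟩⟩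
  have hf : ∀ (ζ : rootsOfUnity ℓ ℂ) j, ((ζ : ℂˣ) : ℂ) ^ ((f.color j : ℕ) + 1) =
      ((ζ : ℂˣ) : ℂ) ^ (n j).toAdd := by
    intro ζ j
    change ((ζ : ℂˣ) : ℂ) ^ (((n j).toAdd + (ℓ - 1)) % ℓ + 1) = _
    rw [pow_succ, ← pow_eq_pow_mod _ (coe_rootsOfUnity_pow ζ), ← pow_succ, add_assoc,
      Nat.sub_add_cancel hpos, pow_add, coe_rootsOfUnity_pow, mul_one]
  have h := congrFun hc (arrowMk f σ)
  rw [show (0 : A ℓ d) (arrowMk f σ) = 0 from rfl] at h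
  rw [Pi.zero_apply, ← h, Finset.sum_apply]
  have hsum : (∑ p, c p • monomialFamily ℓ d p) (arrowMk f σ) =
      ∑ p, c p * monomialFamily ℓ d p (arrowMk f σ) := Finset.sum_apply _ _ _
  rw [hsum, Fintype.sum_prod_type, Finset.sum_eq_single σ]
  · refine Finset.sum_congr rfl fun ζ _ => ?_
    rw [monomialFamily, monomialElement_arrowMk, if_pos rfl]
    simp_rw [hf]
    rfl
  · intro τ _ hτ
    refine Finset.sum_eq_zero fun ζ _ => ?_
    rw [monomialFamily, monomialElement_arrowMk, if_neg hτ.symm, mul_zero]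
  · simp

instance : Module.Finite ℂ (A ℓ d) :=
  inferInstanceAs (Module.Finite ℂ (Arrows (Coloring ℓ d) → ℂ))

theorem finrank_A : Module.finrank ℂ (A ℓ d) =
    Fintype.card (Coloring ℓ d) * Fintype.card (Equiv.Perm (Fin d)) := by
  change Module.finrank ℂ (Arrows (Coloring ℓ d) → ℂ) = _
  rw [Module.finrank_fintype_fun_eq_card, ← Fintype.card_congr (arrowEquiv ℓ d),
    Fintype.card_prod]

theorem card_coloring : Fintype.card (Coloring ℓ d) = ℓ ^ d := by
  have e : Coloring ℓ d ≃ (Fin d → Fin ℓ) := ⟨Coloring.color, Coloring.mk, fun _ => rfl, fun _ => rfl⟩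
  rw [Fintype.card_congr e]
  simp

/-- There are `d! · ℓ^d` independent elements, which is the dimension of `A_(ℓ,d)`. -/
theorem span_monomialFamily [NeZero ℓ] :
    Submodule.span ℂ (Set.range (monomialFamily ℓ d)) = ⊤ := by
  have : Fintype (rootsOfUnity ℓ ℂ) := Fintype.ofFinite _
  refine linearIndependent_monomialFamily.span_eq_top_of_card_eq_finrank' ?_
  rw [finrank_A, card_coloring, Fintype.card_prod, Fintype.card_fun, Fintype.card_fin,
    ← Nat.card_eq_fintype_card (α := rootsOfUnity ℓ ℂ), Complex.card_rootsOfUnity, mul_comm]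

/-! ### The isomorphism from the group algebra to `A_(ℓ,k,d)`. -/

theorem reflectionGroup_exists (X : reflectionGroup ℓ k d) :
    ∃ p : Equiv.Perm (Fin d) × (Fin d → ℂ), (∀ j, p.2 j ^ ℓ = 1 ∧ p.2 j ≠ 0) ∧
      (∏ j, p.2 j) ^ (ℓ / k) = 1 ∧
      ((X : GL (Fin d) ℂ) : Matrix (Fin d) (Fin d) ℂ) = monomialMatrix p.1 p.2 := by
  obtain ⟨σ, z, h⟩ := X.2
  exact ⟨(σ, z), h⟩

/-- The permutation and the nonzero entries of an element of the reflection group. -/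
def monomialData (X : reflectionGroup ℓ k d) : Equiv.Perm (Fin d) × (Fin d → ℂ) :=
  (reflectionGroup_exists X).choose

theorem monomialData_spec (X : reflectionGroup ℓ k d) :
    (∀ j, (monomialData X).2 j ^ ℓ = 1 ∧ (monomialData X).2 j ≠ 0) ∧
      (∏ j, (monomialData X).2 j) ^ (ℓ / k) = 1 ∧
      ((X : GL (Fin d) ℂ) : Matrix (Fin d) (Fin d) ℂ) =
        monomialMatrix (monomialData X).1 (monomialData X).2 :=
  (reflectionGroup_exists X).choose_spec

theorem monomialData_eq {X : reflectionGroup ℓ k d} {σ : Equiv.Perm (Fin d)} {z : Fin d → ℂ}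
    (h : ((X : GL (Fin d) ℂ) : Matrix (Fin d) (Fin d) ℂ) = monomialMatrix σ z) :
    monomialData X = (σ, z) := by
  have hX := monomialData_spec X
  obtain ⟨h₁, h₂⟩ := monomialMatrix_inj (fun j => (hX.1 j).2) (hX.2.2.symm.trans h)
  exact Prod.ext h₁ h₂

theorem exists_quotEmbedding_eq (X : reflectionGroup ℓ k d) :
    ∃ a, quotEmbedding ℓ k d a = monomialElement ℓ (monomialData X).1 (monomialData X).2 := by
  rw [mem_range_quotEmbedding_iff]
  refine rotation_invariant_of_generator _ fun x => ?_
  have hX := monomialData_spec X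
  have := monomialElement_smul (k := k) (σ := (monomialData X).1) (fun j => (hX.1 j).1) x
  rw [hX.2.1, one_mul] at this
  exact this

/-- The element of `A_(ℓ,k,d)` attached to an element of the reflection group. -/
def reflectionElement (X : reflectionGroup ℓ k d) : AQuot ℓ k d :=
  (exists_quotEmbedding_eq X).choose

theorem quotEmbedding_reflectionElement {X : reflectionGroup ℓ k d} {σ : Equiv.Perm (Fin d)}
    {z : Fin d → ℂ}
    (h : ((X : GL (Fin d) ℂ) : Matrix (Fin d) (Fin d) ℂ) = monomialMatrix σ z) :
    quotEmbedding ℓ k d (reflectionElement X) = monomialElement ℓ σ z := by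
  rw [reflectionElement, (exists_quotEmbedding_eq X).choose_spec, monomialData_eq h]

/-- The homomorphism from the reflection group to `A_(ℓ,k,d)`. -/
def reflectionHom (ℓ k d : ℕ) : reflectionGroup ℓ k d →* AQuot ℓ k d where
  toFun := reflectionElement
  map_one' := by
    apply quotEmbedding_injective
    rw [quotEmbedding_reflectionElement (σ := 1) (z := 1) monomialMatrix_one.symm,
      monomialElement_one, map_one]
  map_mul' X Y := by
    apply quotEmbedding_injective
    have hX := (monomialData_spec X).2.2
    have hY := (monomialData_spec Y).2.2
    have hXY : (((X * Y : reflectionGroup ℓ k d) : GL (Fin d) ℂ) : Matrix (Fin d) (Fin d) ℂ) =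
        _ := (congrArg₂ (· * ·) hX hY).trans (monomialMatrix_mul _ _ _ _)
    rw [map_mul, quotEmbedding_reflectionElement hX, quotEmbedding_reflectionElement hY,
      quotEmbedding_reflectionElement hXY, monomialElement_mul]

/-- The index in `monomialFamily` of an element of the reflection group. -/
def familyIndex [NeZero ℓ] (X : reflectionGroup ℓ k d) :
    Equiv.Perm (Fin d) × (Fin d → rootsOfUnity ℓ ℂ) :=
  ((monomialData X).1, fun j => rootsOfUnity.mkOfPowEq _ ((monomialData_spec X).1 j).1)

theorem monomialFamily_familyIndex [NeZero ℓ] (X : reflectionGroup ℓ k d) :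
    monomialFamily ℓ d (familyIndex X) = quotEmbedding ℓ k d (reflectionHom ℓ k d X) := by
  rw [show reflectionHom ℓ k d X = reflectionElement X from rfl,
    quotEmbedding_reflectionElement (monomialData_spec X).2.2, monomialFamily]
  rfl

theorem familyIndex_injective [NeZero ℓ] :
    Function.Injective (familyIndex : reflectionGroup ℓ k d → _) := by
  intro X Y h
  have h₁ : (monomialData X).1 = (monomialData Y).1 :=
    congrArg (fun p : Equiv.Perm (Fin d) × (Fin d → rootsOfUnity ℓ ℂ) => p.1) h
  have h₂ : (monomialData X).2 = (monomialData Y).2 := funext fun j =>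
    congrArg (fun p : Equiv.Perm (Fin d) × (Fin d → rootsOfUnity ℓ ℂ) => ((p.2 j : ℂˣ) : ℂ)) h
  refine Subtype.ext (Units.ext ?_)
  rw [(monomialData_spec X).2.2, (monomialData_spec Y).2.2, h₁, h₂]

theorem exists_reflectionHom_eq [NeZero ℓ] (p : Equiv.Perm (Fin d) × (Fin d → rootsOfUnity ℓ ℂ))
    (hp : (∏ j, ((p.2 j : ℂˣ) : ℂ)) ^ (ℓ / k) = 1) :
    ∃ X, quotEmbedding ℓ k d (reflectionHom ℓ k d X) = monomialFamily ℓ d p := by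
  classical
  have hne : ∀ j, ((p.2 j : ℂˣ) : ℂ) ≠ 0 := fun j => Units.ne_zero _
  have h₁ : monomialMatrix p.1 (fun j => ((p.2 j : ℂˣ) : ℂ)) *
      monomialMatrix p.1⁻¹ (fun j => ((p.2 (p.1⁻¹ j) : ℂˣ) : ℂ)⁻¹) = 1 := by
    rw [monomialMatrix_mul, mul_inv_cancel, ← monomialMatrix_one]
    congr 1
    funext j
    exact mul_inv_cancel₀ (hne _)
  let X : GL (Fin d) ℂ := ⟨_, _, h₁, mul_eq_one_comm.1 h₁⟩
  exact ⟨⟨X, p.1, _, fun j => ⟨coe_rootsOfUnity_pow _, hne j⟩, hp, rfl⟩,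
    quotEmbedding_reflectionElement rfl⟩

/-- The homomorphism from the group algebra of the reflection group to `A_(ℓ,k,d)`. -/
def groupAlgebraHom (ℓ k d : ℕ) : MonoidAlgebra ℂ (reflectionGroup ℓ k d) →ₐ[ℂ] AQuot ℓ k d :=
  MonoidAlgebra.lift ℂ (AQuot ℓ k d) (reflectionGroup ℓ k d) (reflectionHom ℓ k d)

theorem groupAlgebraHom_of (X : reflectionGroup ℓ k d) :
    groupAlgebraHom ℓ k d (MonoidAlgebra.of ℂ _ X) = reflectionHom ℓ k d X :=
  MonoidAlgebra.lift_of _ _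

/-- After the embedding into `A_(ℓ,d)`, distinct group elements become distinct members of an
independent family. -/
theorem groupAlgebraHom_injective [NeZero ℓ] : Function.Injective (groupAlgebraHom ℓ k d) := by
  have hli : LinearIndependent ℂ (reflectionHom ℓ k d : reflectionGroup ℓ k d → AQuot ℓ k d) := by
    refine LinearIndependent.of_comp (quotEmbedding ℓ k d).toLinearMap ?_
    have := (linearIndependent_monomialFamily (ℓ := ℓ) (d := d)).comp _
      (familyIndex_injective (k := k))
    rw [show (quotEmbedding ℓ k d).toLinearMap ∘ (reflectionHom ℓ k d) =
      monomialFamily ℓ d ∘ familyIndex from funext fun X => (monomialFamily_familyIndex X).symm]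
    exact this
  rw [injective_iff_map_eq_zero]
  intro y hy
  rw [groupAlgebraHom, MonoidAlgebra.lift_apply] at hy
  have := linearIndependent_iff.1 hli y.coeff hy
  exact MonoidAlgebra.coeff_injective this

/-- An invariant element is expanded in the basis of monomial elements; the rotation acts diagonally
there, so only members with eigenvalue `1` occur, and these come from the group. -/
theorem groupAlgebraHom_surjective [NeZero ℓ] : Function.Surjective (groupAlgebraHom ℓ k d) := by
  intro y
  have : Fintype (rootsOfUnity ℓ ℂ) := Fintype.ofFinite _
  have hspan : quotEmbedding ℓ k d y ∈ Submodule.span ℂ (Set.range (monomialFamily ℓ d)) := by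
    rw [span_monomialFamily]
    trivial
  obtain ⟨c, hc⟩ := (Submodule.mem_span_range_iff_exists_fun ℂ).1 hspan
  let χ : Equiv.Perm (Fin d) × (Fin d → rootsOfUnity ℓ ℂ) → ℂ :=
    fun p => (∏ j, ((p.2 j : ℂˣ) : ℂ)) ^ (ℓ / k)
  have happ : ∀ (c : _ → ℂ) (x : Arrows (Coloring ℓ d)), (∑ p, c p • monomialFamily ℓ d p) x =
      ∑ p, c p * monomialFamily ℓ d p x := fun c x => Finset.sum_apply _ _ _
  -- The expansion minus its rotation: independence gives `c p * χ p = c p` for every `p`.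
  have hrot : ∑ p, (c p * χ p - c p) • monomialFamily ℓ d p = 0 := by
    simp only [sub_smul, Finset.sum_sub_distrib]
    rw [sub_eq_zero]
    ext x
    have hinv := (mem_range_quotEmbedding_iff (k := k) _).1 ⟨y, rfl⟩ (rotationGenerator ℓ k) x
    rw [← hc, happ, happ] at hinv
    rw [happ, happ, ← hinv]
    refine Finset.sum_congr rfl fun p _ => ?_
    rw [monomialFamily, monomialElement_smul fun j => coe_rootsOfUnity_pow _, mul_assoc]
  have hcoef := Fintype.linearIndependent_iff.1 linearIndependent_monomialFamily _ hrot
  have hmem : quotEmbedding ℓ k d y ∈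
      ((quotEmbedding ℓ k d).comp (groupAlgebraHom ℓ k d)).range := by
    rw [← hc]
    refine Subalgebra.sum_mem _ fun p _ => ?_
    by_cases h0 : c p = 0
    · rw [h0, zero_smul]
      exact zero_mem _
    · have hχ : χ p = 1 := by
        have := hcoef p
        rw [sub_eq_zero] at this
        exact mul_left_cancel₀ h0 (this.trans (mul_one _).symm)
      obtain ⟨X, hX⟩ := exists_reflectionHom_eq p hχ
      refine Subalgebra.smul_mem _ ((AlgHom.mem_range _).2 ⟨MonoidAlgebra.of ℂ _ X, ?_⟩) _
      change quotEmbedding ℓ k d (groupAlgebraHom ℓ k d (MonoidAlgebra.of ℂ _ X)) = _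
      rw [groupAlgebraHom_of, hX]
  obtain ⟨v, hv⟩ := hmem
  exact ⟨v, quotEmbedding_injective hv⟩

end ColorGroupoid
end

theorem theorem4p95 (ℓ k d m : ℕ) (hℓ : 0 < ℓ) (hk : 0 < k) (hkℓ : k ∣ ℓ) (hm : d < m) :
    Subalgebra.centralizer ℂ (Set.range (ColorGroupoid.freeProdTensorRep ℓ k m d)) =
        (ColorGroupoid.quotAction ℓ k m d).range ∧
      Subalgebra.centralizer ℂ (Set.range (ColorGroupoid.quotAction ℓ k m d)) =
        (ColorGroupoid.freeProdTensorRep ℓ k m d).asAlgebraHom.range ∧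
      ∃ e : MonoidAlgebra ℂ (ColorGroupoid.reflectionGroup ℓ k d) ≃ₐ[ℂ]
          ColorGroupoid.AQuot ℓ k d,
        ∀ (X : ColorGroupoid.reflectionGroup ℓ k d) (σ : Equiv.Perm (Fin d)) (z : Fin d → ℂ),
          ((X : GL (Fin d) ℂ) : Matrix (Fin d) (Fin d) ℂ) = ColorGroupoid.monomialMatrix σ z →
            ColorGroupoid.quotEmbedding ℓ k d (e (MonoidAlgebra.of ℂ _ X)) =
              ColorGroupoid.monomialElement ℓ σ z := by
  have : NeZero ℓ := ⟨hℓ.ne'⟩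
  refine ⟨ColorGroupoid.centralizer_range_freeProdTensorRep hm.le,
    ColorGroupoid.centralizer_range_quotAction,
    AlgEquiv.ofBijective (ColorGroupoid.groupAlgebraHom ℓ k d)
      ⟨ColorGroupoid.groupAlgebraHom_injective, ColorGroupoid.groupAlgebraHom_surjective⟩,
    fun X σ z h => ?_⟩
  change ColorGroupoid.quotEmbedding ℓ k d
    (ColorGroupoid.groupAlgebraHom ℓ k d (MonoidAlgebra.of ℂ _ X)) = _
  rw [ColorGroupoid.groupAlgebraHom_of]
  exact ColorGroupoid.quotEmbedding_reflectionElement h
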